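/- Let $Q$ be a smooth manifold and let $L:TQ\to\mathbb{R}$, $L(v)=\tfrac12\kappa(v,v)-U(q)$ for $v\in T_qQ$, be a Lagrangian of mechanical type, with $\kappa$ a Riemannian metric and $U\in C^\infty(Q)$. Let $D\subseteq TQ$ be a smooth distribution of constant rank (the constraints). Put $\mathcal{M}:=\kappa^\flat(D)\subseteq T^*Q$, an embedded submanifold with inclusion $\iota$ and projection $\tau:\mathcal{M}\to Q$. Let $\Theta_Q$ be the canonical 1-form on $T^*Q$, $\Omega_Q=-d\Theta_Q$, $\Theta_{\mathcal{M}}=\iota^*\Theta_Q$, $\Omega_{\mathcal{M}}=\iota^*\Omega_Q$, let $H$ be the Hamiltonian of $L$ and $H_{\mathcal{M}}=\iota^*H$. Let $\mathcal{C}_m=\{v\in T_m\mathcal{M}: T\tau(v)\in D_{\tau(m)}\}$. The nonholonomic vector field $X_{nh}$ is the unique vector field on $\mathcal{M}$ with values in $\mathcal{C}$ such that $\mathbf{i}_{X_{nh}}\Omega_{\mathcal{M}}|_{\mathcal{C}}=dH_{\mathcal{M}}|_{\mathcal{C}}$. Let a Lie group $G$ with Lie algebra $\mathfrak{g}$ act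 smoothly and properly on $Q$ so that the tangent lift leaves $L$ and $D$ invariant; then $G$ acts on $\mathcal{M}$ by the restriction of the cotangent lift. Write $\eta_Q$, $\eta_{\mathcal{M}}$ for the infinitesimal generators of $\eta\in\mathfrak{g}$, and, for a section $\xi$ of $\mathfrak{g}\times Q\to Q$, $\xi_{\mathcal{M}}(m)=(\xi_{\tau(m)})_{\mathcal{M}}(m)$. Let $V_q=\{\eta_Q(q):\eta\in\mathfrak{g}\}$, $S_q=D_q\cap V_q$ and $\mathfrak{g}_S=\{(\xi,q)\in\mathfrak{g}\times Q:\xi_Q(q)\in S_q\}$. Let $W$ be a vertical complement of the constraints, that is, a smooth distribution of constant rank with $TQ=D\oplus W$ and $W\subseteq V$, and assume the vertical-symmetry condition: there is a subspace $\mathfrak{w}\subseteq\mathfrak{g}$ with $\mathrm{Ad}_g(\mathfrak{w})\subseteq\mathfrak{w}$ for all $g\in G$ such that $(\eta,q)\mapsto\eta_Q(q)$ restricts to an isomorphism $\mathfrak{w}\times Q\cong W$. Then $\mathfrak{g}\times Q=\mathfrak{g}_S\oplus(\mathfrak{w}\times Q)$; let $P_{\mathfrak{g}_S}$ be the projection onto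 the first summand. Let $\mathcal{W}_m=\{\eta_{\mathcal{M}}(m):\eta\in\mathfrak{w}\}$, so that $T\mathcal{M}=\mathcal{C}\oplus\mathcal{W}$ with projections $P_{\mathcal{C}},P_{\mathcal{W}}$; let $\mathcal{A}_{\mathcal{W}}:T\mathcal{M}\to\mathfrak{g}$ be the 1-form with $\mathcal{A}_{\mathcal{W}}(v)=\xi\in\mathfrak{w}$ iff $P_{\mathcal{W}}(v)=\xi_{\mathcal{M}}(m)$, for $v\in T_m\mathcal{M}$; let $\mathcal{K}_{\mathcal{W}}(X,Y)=d\mathcal{A}_{\mathcal{W}}(P_{\mathcal{C}}X,P_{\mathcal{C}}Y)$; and let $\langle\mathcal{J},\mathcal{K}_{\mathcal{W}}\rangle$ be its pairing with $\mathcal{J}:\mathcal{M}\to\mathfrak{g}^*$, $\langle\mathcal{J}(\alpha),\eta\rangle=\alpha(\eta_Q(\tau(\alpha)))$. For a section $\xi$ of $\mathfrak{g}_S$ put $\langle J^{nh},\xi\rangle:=\mathbf{i}_{\xi_{\mathcal{M}}}\Theta_{\mathcal{M}}$. A function $J\in C^\infty(\mathcal{M})$ is a horizontal gauge momentum of $X_{nh}$,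 with horizontal gauge symmetry $\chi$, if $\chi\in\Gamma(\mathfrak{g}_S)$ is a smooth section with $J=\langle J^{nh},\chi\rangle$ and $X_{nh}(J)=0$. Let $\{\eta_1,\dots,\eta_N\}$ be a basis of $\mathfrak{g}$ such that $\{\eta_{k+1},\dots,\eta_N\}$ is a basis of $\mathfrak{w}$, and for $i=1,\dots,k$ let $\xi_i=P_{\mathfrak{g}_S}(\eta_i)$ and $j_i=\langle J^{nh},\xi_i\rangle$. Then a function $J$ on $\mathcal{M}$ is a horizontal gauge momentum of $X_{nh}$ if and only if $J=\sum_{i=1}^k(\tau^*f_i)\,j_i$ for some $f_1,\dots,f_k\in C^\infty(Q)$ satisfying on $\mathcal{M}$ the first-order linear partial differential equation $$\sum_{i=1}^k\Big(j_i\,d(\tau^*f_i)(X_{nh})+(\tau^*f_i)\,\langle\mathcal{J},\mathcal{K}_{\mathcal{W}}\rangle\big((\xi_i)_{\mathcal{M}},X_{nh}\big)\Big)=0.$$ The associated horizontal gauge symmetry is $\chi=\sum_{i=1}^k f_i\xi_i$: for all such $f_i$ the section $\sum_i f_i\xi_i$ is a horizontal gauge symmetry of $J$, and every horizontal gauge symmetry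 of $J$ equals $\sum_i f_i\xi_i$ for exactly one tuple $(f_1,\dots,f_k)$ of smooth functions, which satisfies $J=\sum_i(\tau^*f_i)j_i$ and the equation above. -/

import Mathlib

open Set Bundle Manifold Topology
open scoped ContDiff

noncomputable section

namespace Nonholonomic

/-! ### Exterior derivative of a vector-valued 1-form on a manifold -/

/-- Exterior derivative at `x` of the `F`-valued 1-form `α` on a manifold: `α` is read in the
preferred chart at `x`, differentiated there, and the result is pulled back to the tangent space at
`x`. Normalization: `dα(X, Y) = X(α(Y)) - Y(α(X)) - α([X, Y])`. -/
def extDerivOneForm {E H M F : Type*} [NormedAddCommGroup E] [NormedSpace ℝ E]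
    [TopologicalSpace H] (I : ModelWithCorners ℝ E H) [TopologicalSpace M] [ChartedSpace H M]
    [NormedAddCommGroup F] [NormedSpace ℝ F]
    (α : ∀ x : M, TangentSpace I x →L[ℝ] F) (x : M) : TangentSpace I x [⋀^Fin 2]→L[ℝ] F :=
  (extDerivWithin
      (fun y : E ↦ ContinuousAlternatingMap.ofSubsingleton ℝ E F (0 : Fin 1)
        ((α ((extChartAt I x).symm y)).comp
          (mfderivWithin 𝓘(ℝ, E) I (extChartAt I x).symm (range I) y)))
      (range I) (extChartAt I x x)).compContinuousLinearMap
    (mfderiv I 𝓘(ℝ, E) (extChartAt I x) x)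

/-! ### Cotangent bundle -/

section Cotangent

variable (E : Type*) [NormedAddCommGroup E] [NormedSpace ℝ E]
  (Q : Type*) [TopologicalSpace Q] [ChartedSpace E Q] [IsManifold 𝓘(ℝ, E) ∞ Q]

/-- The cotangent bundle `T*Q`, with Mathlib's smooth structure on bundles of linear maps. -/
abbrev Cotangent : Type _ :=
  TotalSpace (E →L[ℝ] ℝ) (fun q : Q ↦ TangentSpace 𝓘(ℝ, E) q →L[ℝ] ℝ)

/-- The model with corners of `T*Q`. -/
abbrev cotangentModel : ModelWithCorners ℝ (E × (E →L[ℝ] ℝ)) (ModelProd E (E →L[ℝ] ℝ)) :=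
  𝓘(ℝ, E).prod 𝓘(ℝ, E →L[ℝ] ℝ)

variable {E Q}

/-- The canonical 1-form `Θ_Q` on `T*Q`: `Θ_Q(α)(v) = α(Tπ v)`. -/
def canonicalOneForm (α : Cotangent E Q) : TangentSpace (cotangentModel E) α →L[ℝ] ℝ :=
  α.2.comp (mfderiv (cotangentModel E) 𝓘(ℝ, E) (fun β : Cotangent E Q ↦ β.proj) α)

/-- The canonical 2-form `Ω_Q = -dΘ_Q` on `T*Q`. -/
def canonicalTwoForm (α : Cotangent E Q) :
    TangentSpace (cotangentModel E) α [⋀^Fin 2]→L[ℝ] ℝ :=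
  -extDerivOneForm (cotangentModel E) canonicalOneForm α

end Cotangent

/-! ### Distributions and nonholonomic systems -/

/-- `D` is a smooth distribution of constant rank `r`: near every point it is spanned by a
linearly independent family of `r` smooth vector fields. -/
def IsSmoothDistribution {E : Type*} [NormedAddCommGroup E] [NormedSpace ℝ E]
    {Q : Type*} [TopologicalSpace Q] [ChartedSpace E Q] [IsManifold 𝓘(ℝ, E) ∞ Q]
    (D : ∀ q : Q, Submodule ℝ (TangentSpace 𝓘(ℝ, E) q)) (r : ℕ) : Prop :=
  ∀ q₀ : Q, ∃ u ∈ 𝓝 q₀, ∃ X : Fin r → ∀ q : Q, TangentSpace 𝓘(ℝ, E) q,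
    (∀ i, ContMDiffOn 𝓘(ℝ, E) 𝓘(ℝ, E).tangent ∞
      (fun q ↦ (⟨q, X i q⟩ : TangentBundle 𝓘(ℝ, E) Q)) u) ∧
    ∀ q ∈ u, LinearIndependent ℝ (fun i ↦ X i q) ∧
      Submodule.span ℝ (range fun i ↦ X i q) = D q

/-- A nonholonomic system on `Q`: a Lagrangian of mechanical type, given by a kinetic energy
metric `κ` and a potential `U`, and a constraint distribution `D` of constant rank. -/
structure System (E : Type*) [NormedAddCommGroup E] [NormedSpace ℝ E]
    (Q : Type*) [TopologicalSpace Q] [ChartedSpace E Q] [IsManifold 𝓘(ℝ, E) ∞ Q] where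
  /-- the kinetic energy metric -/
  κ : ContMDiffRiemannianMetric 𝓘(ℝ, E) ∞ E (fun q : Q ↦ TangentSpace 𝓘(ℝ, E) q)
  /-- the potential energy -/
  U : Q → ℝ
  contMDiff_U : ContMDiff 𝓘(ℝ, E) 𝓘(ℝ, ℝ) ∞ U
  /-- the constraint distribution -/
  D : ∀ q : Q, Submodule ℝ (TangentSpace 𝓘(ℝ, E) q)
  /-- its rank -/
  rank : ℕ
  isSmoothDistribution_D : IsSmoothDistribution D rank

namespace System

section Basic

variable {E : Type*} [NormedAddCommGroup E] [NormedSpace ℝ E]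
  {Q : Type*} [TopologicalSpace Q] [ChartedSpace E Q] [IsManifold 𝓘(ℝ, E) ∞ Q]
  (S : System E Q)

/-- The Lagrangian `L(q, v) = κ(v, v) / 2 - U(q)` on `TQ`. -/
def lagrangian (x : TangentBundle 𝓘(ℝ, E) Q) : ℝ :=
  S.κ.inner x.proj x.2 x.2 / 2 - S.U x.proj

/-- The Hamiltonian on `T*Q`: the Legendre transform `H(α) = α(v) - L(v)`, where
`v = (κ^♭)⁻¹(α)`. -/
def hamiltonian (α : Cotangent E Q) : ℝ :=
  α.2 ((S.κ.inner α.proj).inverse α.2) -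
    S.lagrangian ⟨α.proj, (S.κ.inner α.proj).inverse α.2⟩

/-- The constraint submanifold `κ^♭(D)` as a subset of `T*Q`. -/
def constraintSet : Set (Cotangent E Q) :=
  {α | ∃ v ∈ S.D α.proj, S.κ.inner α.proj v = α.2}

/-- The constraint submanifold `𝓜 = κ^♭(D)`, with the topology induced from `T*Q`. -/
abbrev Constraint : Type _ := ↥S.constraintSet

/-- The inclusion `ι : 𝓜 → T*Q`. -/
def incl (m : S.Constraint) : Cotangent E Q := m.1

/-- The projection `τ : 𝓜 → Q`. -/
def proj (m : S.Constraint) : Q := m.1.proj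

end Basic

/-! ### The nonholonomic vector field -/

section Dynamics

variable {E : Type*} [NormedAddCommGroup E] [NormedSpace ℝ E]
  {Q : Type*} [TopologicalSpace Q] [ChartedSpace E Q] [IsManifold 𝓘(ℝ, E) ∞ Q]
  (S : System E Q)
  {EM : Type*} [NormedAddCommGroup EM] [NormedSpace ℝ EM] [ChartedSpace EM S.Constraint]

/-- `Θ_𝓜 = ι^* Θ_Q`. -/
def oneFormM (m : S.Constraint) : TangentSpace 𝓘(ℝ, EM) m →L[ℝ] ℝ :=
  (canonicalOneForm (S.incl m)).comp (mfderiv 𝓘(ℝ, EM) (cotangentModel E) S.incl m)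

/-- `Ω_𝓜 = ι^* Ω_Q`. -/
def twoFormM (m : S.Constraint) : TangentSpace 𝓘(ℝ, EM) m [⋀^Fin 2]→L[ℝ] ℝ :=
  (canonicalTwoForm (S.incl m)).compContinuousLinearMap
    (mfderiv 𝓘(ℝ, EM) (cotangentModel E) S.incl m)

/-- `H_𝓜 = ι^* H`. -/
def hamiltonianM (m : S.Constraint) : ℝ := S.hamiltonian (S.incl m)

/-- The derivative `X(F) = dF(X)` of a function `F` on `𝓜` in the direction of a tangent vector. -/
def deriv (F : S.Constraint → ℝ) (m : S.Constraint) (X : TangentSpace 𝓘(ℝ, EM) m) : ℝ :=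
  mfderiv 𝓘(ℝ, EM) 𝓘(ℝ, ℝ) F m X

/-- The distribution `𝓒` on `𝓜`: `𝓒_m = {v ∈ T_m𝓜 : Tτ(v) ∈ D_{τ(m)}}`. -/
def constraintDistribution (m : S.Constraint) : Submodule ℝ (TangentSpace 𝓘(ℝ, EM) m) :=
  (S.D (S.proj m)).comap (mfderiv 𝓘(ℝ, EM) 𝓘(ℝ, E) S.proj m).toLinearMap

/-- `X` is the value at `m` of the nonholonomic vector field: it lies in `𝓒_m`, and
`i_X Ω_𝓜 |_𝓒 = dH_𝓜 |_𝓒` at `m`. -/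
def IsNonholonomicVector (m : S.Constraint) (X : TangentSpace 𝓘(ℝ, EM) m) : Prop :=
  X ∈ S.constraintDistribution (EM := EM) m ∧
    ∀ w ∈ S.constraintDistribution (EM := EM) m,
      S.twoFormM m ![X, w] = S.deriv S.hamiltonianM m w

open Classical in
/-- The nonholonomic vector field `X_nh` on `𝓜`: its value at `m` is the vector singled out by
`IsNonholonomicVector`, which exists and is unique because `Ω_𝓜 |_𝓒` is nondegenerate. -/
def nonholonomicField (m : S.Constraint) : TangentSpace 𝓘(ℝ, EM) m :=
  if h : ∃ X : TangentSpace 𝓘(ℝ, EM) m, S.IsNonholonomicVector m X then h.choose else 0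

end Dynamics

/-! ### Symmetries -/

section Symmetry

variable {E : Type*} [NormedAddCommGroup E] [NormedSpace ℝ E]
  {Q : Type*} [TopologicalSpace Q] [ChartedSpace E Q] [IsManifold 𝓘(ℝ, E) ∞ Q]
  {EG : Type*} [NormedAddCommGroup EG] [NormedSpace ℝ EG]
  {G : Type*} [TopologicalSpace G] [ChartedSpace EG G] [Group G] [MulAction G Q]

/-- The tangent lift of the `G`-action leaves the Lagrangian and the distribution invariant. -/
structure IsSymmetry (S : System E Q) (G : Type*) [Group G] [MulAction G Q] : Prop where
  lagrangian_inv : ∀ (g : G) (x : TangentBundle 𝓘(ℝ, E) Q),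
    S.lagrangian (tangentMap 𝓘(ℝ, E) 𝓘(ℝ, E) (fun p : Q ↦ g • p) x) = S.lagrangian x
  distribution_inv : ∀ (g : G) (q : Q), ∀ v ∈ S.D q,
    mfderiv 𝓘(ℝ, E) 𝓘(ℝ, E) (fun p : Q ↦ g • p) q v ∈ S.D (g • q)

/-- The cotangent lift of the action of `g` to `T*Q`: it sends `α ∈ T_q^*Q` to
`α ∘ (T_q g)⁻¹ ∈ T_{gq}^*Q`. -/
def cotangentLift {G : Type*} [Group G] [MulAction G Q] (g : G) (α : Cotangent E Q) : Cotangent E Q :=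
  ⟨g • α.proj,
    α.2.comp (mfderiv 𝓘(ℝ, E) 𝓘(ℝ, E) (fun p : Q ↦ g • p) α.proj).inverse⟩

/-- The infinitesimal generator map `Ψ_q : 𝔤 → T_qQ`, `η ↦ η_Q(q)`: the derivative at `1` of the
orbit map `g ↦ g • q`. -/
def generator (E : Type*) [NormedAddCommGroup E] [NormedSpace ℝ E]
    {Q : Type*} [TopologicalSpace Q] [ChartedSpace E Q]
    (EG : Type*) [NormedAddCommGroup EG] [NormedSpace ℝ EG]
    (G : Type*) [TopologicalSpace G] [ChartedSpace EG G] [Group G] [MulAction G Q] (q : Q) :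
    GroupLieAlgebra 𝓘(ℝ, EG) G →L[ℝ] TangentSpace 𝓘(ℝ, E) q :=
  mfderiv 𝓘(ℝ, EG) 𝓘(ℝ, E) (fun g : G ↦ g • q) 1

/-- The adjoint action of `g` on `𝔤`: the derivative at `1` of `h ↦ g h g⁻¹`. -/
def Ad {EG : Type*} [NormedAddCommGroup EG] [NormedSpace ℝ EG]
    {G : Type*} [TopologicalSpace G] [ChartedSpace EG G] [Group G] (g : G) :
    GroupLieAlgebra 𝓘(ℝ, EG) G →L[ℝ] GroupLieAlgebra 𝓘(ℝ, EG) G :=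
  mfderiv 𝓘(ℝ, EG) 𝓘(ℝ, EG) (fun h : G ↦ g * h * g⁻¹) 1

/-- `V_q`: the tangent space at `q` to the `G`-orbit. -/
def vertical (E : Type*) [NormedAddCommGroup E] [NormedSpace ℝ E]
    {Q : Type*} [TopologicalSpace Q] [ChartedSpace E Q]
    (EG : Type*) [NormedAddCommGroup EG] [NormedSpace ℝ EG]
    (G : Type*) [TopologicalSpace G] [ChartedSpace EG G] [Group G] [MulAction G Q] (q : Q) :
    Submodule ℝ (TangentSpace 𝓘(ℝ, E) q) :=
  LinearMap.range (generator E EG G q).toLinearMap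

variable (S : System E Q)

/-- The bundle `𝔤_S`, with fibre `{ξ ∈ 𝔤 : ξ_Q(q) ∈ S_q = D_q ∩ V_q}` at `q`. -/
def gS (EG : Type*) [NormedAddCommGroup EG] [NormedSpace ℝ EG]
    (G : Type*) [TopologicalSpace G] [ChartedSpace EG G] [Group G] [MulAction G Q] (q : Q) :
    Submodule ℝ (GroupLieAlgebra 𝓘(ℝ, EG) G) :=
  (S.D q ⊓ vertical E EG G q).comap (generator E EG G q).toLinearMap

/-- `W` is a vertical complement of the constraints: a smooth constant rank distribution with
`TQ = D ⊕ W` and `W ⊆ V`. -/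
structure IsVerticalComplement (EG : Type*) [NormedAddCommGroup EG] [NormedSpace ℝ EG]
    (G : Type*) [TopologicalSpace G] [ChartedSpace EG G] [Group G] [MulAction G Q]
    (W : ∀ q : Q, Submodule ℝ (TangentSpace 𝓘(ℝ, E) q)) : Prop where
  smooth : ∃ r : ℕ, IsSmoothDistribution W r
  isCompl : ∀ q, IsCompl (S.D q) (W q)
  le_vertical : ∀ q, W q ≤ vertical E EG G q

/-- `W` satisfies the vertical-symmetry condition with the subspace `𝔴` of `𝔤`: `𝔴` is
`Ad`-invariant, and `Ψ` restricts to an isomorphism from `𝔴 × Q` onto `W`. -/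
structure VerticalSymmetry (W : ∀ q : Q, Submodule ℝ (TangentSpace 𝓘(ℝ, E) q))
    (w : Submodule ℝ (GroupLieAlgebra 𝓘(ℝ, EG) G)) : Prop where
  ad_mem : ∀ (g : G), ∀ η ∈ w, Ad (EG := EG) g η ∈ w
  injOn : ∀ q : Q, InjOn (generator E EG G q) w
  map_eq : ∀ q : Q, w.map (generator E EG G q).toLinearMap = W q

variable {S}

/-- `𝔤 = 𝔤_S(q) ⊕ 𝔴` for every `q`. -/
theorem isCompl_gS {W : ∀ q : Q, Submodule ℝ (TangentSpace 𝓘(ℝ, E) q)}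
    {w : Submodule ℝ (GroupLieAlgebra 𝓘(ℝ, EG) G)}
    (hW : S.IsVerticalComplement EG G W) (hw : VerticalSymmetry W w) (q : Q) :
    IsCompl (S.gS EG G q) w := by
  constructor
  · rw [Submodule.disjoint_def]
    intro ξ hξ hξw
    have h1 : generator E EG G q ξ ∈ S.D q := hξ.1
    have h2 : generator E EG G q ξ ∈ W q := by
      rw [← hw.map_eq q]
      exact ⟨ξ, hξw, rfl⟩
    have h3 := (Submodule.disjoint_def.1 (hW.isCompl q).disjoint) _ h1 h2
    refine hw.injOn q hξw w.zero_mem ?_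
    rw [h3, map_zero]
  · rw [codisjoint_iff, Submodule.eq_top_iff']
    intro η
    have h0 : generator E EG G q η ∈ S.D q ⊔ W q := by
      rw [(hW.isCompl q).sup_eq_top]
      exact Submodule.mem_top
    obtain ⟨d, hd, x, hx, hdx⟩ := Submodule.mem_sup.1 h0
    rw [← hw.map_eq q] at hx
    obtain ⟨ζ, hζ, rfl⟩ := hx
    refine Submodule.mem_sup.2 ⟨η - ζ, ?_, ζ, hζ, sub_add_cancel _ _⟩
    have h1 : generator E EG G q (η - ζ) = d := by
      rw [map_sub, ← hdx]
      exact add_sub_cancel_right _ _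
    refine ⟨?_, ⟨η - ζ, rfl⟩⟩
    change generator E EG G q (η - ζ) ∈ S.D q
    rw [h1]
    exact hd

/-- The projection `P_{𝔤_S} : 𝔤 × Q → 𝔤_S` along `𝔴 × Q`, applied to the constant section `η`. -/
def projGS {W : ∀ q : Q, Submodule ℝ (TangentSpace 𝓘(ℝ, E) q)}
    {w : Submodule ℝ (GroupLieAlgebra 𝓘(ℝ, EG) G)}
    (hW : S.IsVerticalComplement EG G W) (hw : VerticalSymmetry W w)
    (η : GroupLieAlgebra 𝓘(ℝ, EG) G) (q : Q) : GroupLieAlgebra 𝓘(ℝ, EG) G :=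
  (S.gS EG G q).projection w (isCompl_gS hW hw q) η

/-- The cotangent lift of a symmetry leaves `𝓜` invariant. -/
theorem IsSymmetry.cotangentLift_mem (EG : Type*) [NormedAddCommGroup EG] [NormedSpace ℝ EG]
    {G : Type*} [TopologicalSpace G] [ChartedSpace EG G] [Group G] [MulAction G Q]
    [ContMDiffSMul 𝓘(ℝ, EG) 𝓘(ℝ, E) ∞ G Q] (hS : S.IsSymmetry G) (g : G) {α : Cotangent E Q}
    (hα : α ∈ S.constraintSet) : cotangentLift g α ∈ S.constraintSet := by
  obtain ⟨v, hv, hvα⟩ := hα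
  have hinv : ∀ q : Q, ∃ A : TangentSpace 𝓘(ℝ, E) q ≃L[ℝ] TangentSpace 𝓘(ℝ, E) (g • q),
      mfderiv 𝓘(ℝ, E) 𝓘(ℝ, E) (fun p : Q ↦ g • p) q = A := fun q ↦
    ⟨(Diffeomorph.smul 𝓘(ℝ, EG) 𝓘(ℝ, E) ∞ g).mfderivToContinuousLinearEquiv (by simp) q, rfl⟩
  obtain ⟨A, hA⟩ := hinv α.proj
  have hL : ∀ x : TangentSpace 𝓘(ℝ, E) α.proj,
      S.κ.inner (g • α.proj) (A x) (A x) / 2 - S.U (g • α.proj) =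
        S.κ.inner α.proj x x / 2 - S.U α.proj := by
    intro x
    have h := hS.lagrangian_inv g ⟨α.proj, x⟩
    simp only [lagrangian, tangentMap, hA] at h
    exact h
  have hsq : ∀ x : TangentSpace 𝓘(ℝ, E) α.proj,
      S.κ.inner (g • α.proj) (A x) (A x) = S.κ.inner α.proj x x := by
    intro x
    have h0 := hL 0
    have h1 := hL x
    simp only [map_zero] at h0
    linarith
  have hpol : ∀ x y : TangentSpace 𝓘(ℝ, E) α.proj,
      S.κ.inner (g • α.proj) (A x) (A y) = S.κ.inner α.proj x y := by
    intro x y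
    have h := hsq (x + y)
    simp only [map_add, add_apply] at h
    have h1 := hsq x
    have h2 := hsq y
    have h3 := S.κ.symm (g • α.proj) (A x) (A y)
    have h4 := S.κ.symm α.proj x y
    linarith
  refine ⟨A v, ?_, ?_⟩
  · have h := hS.distribution_inv g α.proj v hv
    rw [hA] at h
    exact h
  · change S.κ.inner (g • α.proj) (A v) =
      α.2.comp (mfderiv 𝓘(ℝ, E) 𝓘(ℝ, E) (fun p : Q ↦ g • p) α.proj).inverse
    rw [hA, ContinuousLinearMap.inverse_equiv, ← hvα]
    ext y
    obtain ⟨x, rfl⟩ := A.surjective y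
    rw [hpol]
    simp

/-- The `G`-action on `𝓜`, restriction of the cotangent lift. -/
def act (EG : Type*) [NormedAddCommGroup EG] [NormedSpace ℝ EG]
    {G : Type*} [TopologicalSpace G] [ChartedSpace EG G] [Group G] [MulAction G Q]
    [ContMDiffSMul 𝓘(ℝ, EG) 𝓘(ℝ, E) ∞ G Q] (hS : S.IsSymmetry G) (g : G) (m : S.Constraint) :
    S.Constraint :=
  ⟨cotangentLift g m.1, hS.cotangentLift_mem EG g m.2⟩

end Symmetry

/-! ### The 2-form `⟨𝒥, 𝒦_𝓦⟩`, the nonholonomic momentum map and gauge momenta -/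

section Momentum

variable {E : Type*} [NormedAddCommGroup E] [NormedSpace ℝ E]
  {Q : Type*} [TopologicalSpace Q] [ChartedSpace E Q] [IsManifold 𝓘(ℝ, E) ∞ Q]
  {EG : Type*} [NormedAddCommGroup EG] [NormedSpace ℝ EG]
  {G : Type*} [TopologicalSpace G] [ChartedSpace EG G] [Group G] [MulAction G Q]
  [ContMDiffSMul 𝓘(ℝ, EG) 𝓘(ℝ, E) ∞ G Q]
  {S : System E Q}
  {EM : Type*} [NormedAddCommGroup EM] [NormedSpace ℝ EM] [ChartedSpace EM S.Constraint]

/-- The infinitesimal generator map of the action on `𝓜`: `η ↦ η_𝓜(m)`. -/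
def generatorM (hS : S.IsSymmetry G) (m : S.Constraint) :
    GroupLieAlgebra 𝓘(ℝ, EG) G →L[ℝ] TangentSpace 𝓘(ℝ, EM) m :=
  mfderiv 𝓘(ℝ, EG) 𝓘(ℝ, EM) (fun g : G ↦ act EG hS g m) 1

/-- The vector field `ξ_𝓜` on `𝓜` of a section `ξ` of `𝔤 × Q`: `ξ_𝓜(m) = (ξ_{τ(m)})_𝓜(m)`. -/
def sectionFieldM (hS : S.IsSymmetry G) (ξ : Q → GroupLieAlgebra 𝓘(ℝ, EG) G) (m : S.Constraint) :
    TangentSpace 𝓘(ℝ, EM) m :=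
  generatorM hS m (ξ (S.proj m))

/-- The distribution `𝓦` on `𝓜` spanned by the infinitesimal generators of elements of `𝔴`. -/
def distributionW (hS : S.IsSymmetry G) (w : Submodule ℝ (GroupLieAlgebra 𝓘(ℝ, EG) G))
    (m : S.Constraint) : Submodule ℝ (TangentSpace 𝓘(ℝ, EM) m) :=
  w.map (generatorM hS m).toLinearMap

open Classical in
/-- The 1-form `𝒜_𝓦 : T𝓜 → 𝔤`: `𝒜_𝓦(v)` is the element `ξ` of `𝔴` with `P_𝓦(v) = ξ_𝓜(m)`, where
`P_𝓦` is the projection onto `𝓦_m` along `𝓒_m`; that is, `v - ξ_𝓜(m) ∈ 𝓒_m`. Such a linear map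
exists and is unique under the vertical-symmetry condition. The Lie algebra `𝔤` is, by definition,
the model space `EG`, whose norm is used to differentiate the form. -/
def connectionForm (hS : S.IsSymmetry G) (w : Submodule ℝ (GroupLieAlgebra 𝓘(ℝ, EG) G))
    (m : S.Constraint) : TangentSpace 𝓘(ℝ, EM) m →L[ℝ] EG :=
  if h : ∃ A : TangentSpace 𝓘(ℝ, EM) m →L[ℝ] GroupLieAlgebra 𝓘(ℝ, EG) G,
      ∀ v, A v ∈ w ∧ v - generatorM hS m (A v) ∈ S.constraintDistribution (EM := EM) m
  then h.choose else 0

/-- The projection `P_𝓒` onto `𝓒_m` along `𝓦_m`. -/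
def projC (hS : S.IsSymmetry G) (w : Submodule ℝ (GroupLieAlgebra 𝓘(ℝ, EG) G))
    (m : S.Constraint) (v : TangentSpace 𝓘(ℝ, EM) m) : TangentSpace 𝓘(ℝ, EM) m :=
  v - generatorM hS m (connectionForm hS w m v)

/-- The `𝓦`-curvature `𝒦_𝓦(u, v) = d𝒜_𝓦(P_𝓒 u, P_𝓒 v)`. -/
def curvature (hS : S.IsSymmetry G) (w : Submodule ℝ (GroupLieAlgebra 𝓘(ℝ, EG) G))
    (m : S.Constraint) (u v : TangentSpace 𝓘(ℝ, EM) m) : GroupLieAlgebra 𝓘(ℝ, EG) G :=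
  extDerivOneForm 𝓘(ℝ, EM) (connectionForm hS w) m ![projC hS w m u, projC hS w m v]

/-- The restriction `𝒥 : 𝓜 → 𝔤^*` of the canonical momentum map of `T*Q`:
`⟨𝒥(α), η⟩ = α(η_Q(q))` for `α ∈ T_q^*Q`. -/
def momentumMap (m : S.Constraint) : GroupLieAlgebra 𝓘(ℝ, EG) G →L[ℝ] ℝ :=
  (S.incl m).2.comp (generator E EG G (S.proj m))

/-- The 2-form `⟨𝒥, 𝒦_𝓦⟩` on `𝓜`. -/
def formJK (hS : S.IsSymmetry G) (w : Submodule ℝ (GroupLieAlgebra 𝓘(ℝ, EG) G))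
    (m : S.Constraint) (u v : TangentSpace 𝓘(ℝ, EM) m) : ℝ :=
  momentumMap (EG := EG) (G := G) m (curvature hS w m u v)

variable (EM) in
/-- The function `⟨J^nh, ξ⟩ = i_{ξ_𝓜} Θ_𝓜` on `𝓜`. -/
def nhMomentum (hS : S.IsSymmetry G) (ξ : Q → GroupLieAlgebra 𝓘(ℝ, EG) G) (m : S.Constraint) :
    ℝ :=
  S.oneFormM (EM := EM) m (sectionFieldM hS ξ m)

variable (EM) in
/-- `χ` is a horizontal gauge symmetry, with horizontal gauge momentum `J`: `χ` is a smooth section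
of `𝔤_S`, `J` is a smooth function on `𝓜`, `J = ⟨J^nh, χ⟩` and `X_nh(J) = 0`. -/
structure IsHorizontalGaugeSymmetry (hS : S.IsSymmetry G)
    (χ : Q → GroupLieAlgebra 𝓘(ℝ, EG) G) (J : S.Constraint → ℝ) : Prop where
  contMDiff_section : ContMDiff (M' := EG) 𝓘(ℝ, E) 𝓘(ℝ, EG) ∞ χ
  mem_gS : ∀ q, χ q ∈ S.gS EG G q
  contMDiff_momentum : ContMDiff 𝓘(ℝ, EM) 𝓘(ℝ, ℝ) ∞ J
  eq_nhMomentum : ∀ m, J m = nhMomentum EM hS χ m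
  conserved : ∀ m, S.deriv J m (S.nonholonomicField (EM := EM) m) = 0

variable (EM) in
/-- `J` is a horizontal gauge momentum of `X_nh`. -/
def IsHorizontalGaugeMomentum (EG : Type*) [NormedAddCommGroup EG] [NormedSpace ℝ EG]
    {G : Type*} [TopologicalSpace G] [ChartedSpace EG G] [Group G] [MulAction G Q]
    [ContMDiffSMul 𝓘(ℝ, EG) 𝓘(ℝ, E) ∞ G Q]
    (hS : S.IsSymmetry G) (J : S.Constraint → ℝ) : Prop :=
  ∃ χ : Q → GroupLieAlgebra 𝓘(ℝ, EG) G, IsHorizontalGaugeSymmetry EM hS χ J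

variable (EM) in
/-- The momentum equation for functions `f_i` on `Q` and sections `ξ_i` of `𝔤_S`:
`∑ (j_i df_i(X_nh) + f_i ⟨𝒥, 𝒦_𝓦⟩((ξ_i)_𝓜, X_nh)) = 0` on `𝓜`, where `j_i = ⟨J^nh, ξ_i⟩` and
functions on `Q` are pulled back to `𝓜` by `τ`. -/
def MomentumEquation (hS : S.IsSymmetry G) (w : Submodule ℝ (GroupLieAlgebra 𝓘(ℝ, EG) G))
    {k : ℕ} (ξ : Fin k → Q → GroupLieAlgebra 𝓘(ℝ, EG) G) (f : Fin k → Q → ℝ) : Prop :=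
  ∀ m : S.Constraint,
    ∑ i, (nhMomentum EM hS (ξ i) m *
        S.deriv (fun m' ↦ f i (S.proj m')) m (S.nonholonomicField (EM := EM) m) +
      f i (S.proj m) *
        formJK hS w m (sectionFieldM hS (ξ i) m) (S.nonholonomicField (EM := EM) m)) = 0

end Momentum

end System

end Nonholonomic

end

/-! The proof rests on two identities for the value of `X_nh` at a point `m` over `q`. The first is
a pointwise Noether identity, `deriv_momentumMap_nonholonomicField`. For a fixed `η ∈ 𝔤` with
`η_Q(q) ∈ D_q`, the momentum map property gives `d⟨𝒥, η⟩(X_nh) = Ω_𝓜(η_𝓜, X_nh) = -Ω_𝓜(X_nh, η_𝓜) =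
-dH_𝓜(η_𝓜) = 0`. The condition on `η` is needed only at `m`, where it places `η_𝓜(m)` in `𝓒`.

The second is `curvature_projGS`. The form `𝒜_𝓦` vanishes on `𝓒`, and `𝓒` is preserved by the
action, so Cartan's formula `extDerivOneForm_generator` applies with a vector of `𝓒` as second
argument. With `ξ` frozen at its value at `q`, `d𝒜_𝓦(ξ_𝓜, X) = -X(𝒜_𝓦(ξ_𝓜))`. By `projW_projGS` the
right side is the derivative along `X` of the `𝔤`-valued function `P_{𝔤_S}(η)`: since `𝔴` does not
vary with the point, projecting the frozen value elsewhere recovers that function up to sign and a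
constant.

Now differentiate `⟨𝒥, P_{𝔤_S}(η)⟩` by the product rule. The first identity removes the term where
`𝒥` varies, and the second identifies the other one, so `X_nh(j_i) = ⟨𝒥, 𝒦_𝓦⟩((ξ_i)_𝓜, X_nh)`. By
the Leibniz rule the momentum equation is then `X_nh(J) = 0` (`momentumEquation_iff`).

What remains is linear algebra. The `ξ_i` form a frame of `𝔤_S`, and the coefficients of a section
are its first `k` coordinates in the basis of `𝔤`, hence smooth and unique. Smoothness of the `ξ_i`
comes from inverting a smooth family of frames in `contMDiffAt_baseConnectionInTriv`. -/

noncomputable section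

namespace Nonholonomic

open Nonholonomic.System

/-! ### Two-parameter maps in a vector space. -/

section VectorSpace

variable {V W : Type*} [NormedAddCommGroup V] [NormedSpace ℝ V] [NormedAddCommGroup W]
  [NormedSpace ℝ W]

/-- Differentiating a 1-form along one parameter of a two-parameter map, evaluated on the velocity
in the other parameter. -/
theorem hasDerivAt_oneForm_fderiv {β : V → V →L[ℝ] W} {F : ℝ × ℝ → V} {a b : ℝ × ℝ}
    {β' : V →L[ℝ] V →L[ℝ] W} (hβ : HasFDerivAt β β' (F 0)) (hF : ContDiffAt ℝ 2 F 0) :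
    HasDerivAt (fun s : ℝ ↦ β (F (s • a)) (fderiv ℝ F (s • a) b))
      (β' (fderiv ℝ F 0 a) (fderiv ℝ F 0 b) + β (F 0) (fderiv ℝ (fderiv ℝ F) 0 a b)) 0 := by
  have hl : HasDerivAt (fun s : ℝ ↦ s • a) a 0 := by
    simpa using (hasDerivAt_id (0 : ℝ)).smul_const a
  have h0 : (0 : ℝ) • a = 0 := zero_smul ℝ a
  have hF1 : HasFDerivAt F (fderiv ℝ F 0) ((0 : ℝ) • a) := by
    rw [h0]; exact (hF.differentiableAt (by norm_num)).hasFDerivAt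
  have hF2 : HasFDerivAt (fderiv ℝ F) (fderiv ℝ (fderiv ℝ F) 0) ((0 : ℝ) • a) := by
    rw [h0]
    exact ((hF.fderiv_right (m := 1) (by norm_num)).differentiableAt (by norm_num)).hasFDerivAt
  have h1 := hF1.comp_hasDerivAt 0 hl
  have h2 := hF2.comp_hasDerivAt 0 hl
  have hβ' : HasFDerivAt β β' ((F ∘ fun s : ℝ ↦ s • a) 0) := by
    simpa [h0] using hβ
  have h3 := hβ'.comp_hasDerivAt 0 h1
  have h4 := h3.clm_apply (h2.clm_apply (hasDerivAt_const (0 : ℝ) b))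
  simpa [h0] using h4

/-- This symmetry cancels the second-order terms when the two mixed derivatives of a 1-form are
subtracted. -/
theorem fderiv_fderiv_comm {F : ℝ × ℝ → V} (hF : ContDiffAt ℝ 2 F 0) (a b : ℝ × ℝ) :
    fderiv ℝ (fderiv ℝ F) 0 a b = fderiv ℝ (fderiv ℝ F) 0 b a :=
  (hF.isSymmSndFDerivAt (by simp)).eq a b

end VectorSpace

/-! ### Exterior derivatives in charts, along two-parameter maps, and on infinitesimal generators.
-/

section ExtDeriv

variable {E H N F : Type*} [NormedAddCommGroup E] [NormedSpace ℝ E]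
    [TopologicalSpace H] {I : ModelWithCorners ℝ E H} [TopologicalSpace N]
    [ChartedSpace H N] [NormedAddCommGroup F] [NormedSpace ℝ F]

/-- A 1-form read in the preferred chart at `n`. -/
def oneFormInChart (I : ModelWithCorners ℝ E H) (β : ∀ x : N, TangentSpace I x →L[ℝ] F) (n : N)
    (y : E) : E →L[ℝ] F :=
  (β ((extChartAt I n).symm y)).comp
    (mfderivWithin 𝓘(ℝ, E) I (extChartAt I n).symm (range I) y)

/-- Without boundary the chart range is the whole model space, so an ordinary derivative is
alternated, and over `Fin 2` the alternating sum has two terms. -/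
theorem extDerivOneForm_apply [I.Boundaryless] {β : ∀ x : N, TangentSpace I x →L[ℝ] F} {n : N}
    {β' : E →L[ℝ] E →L[ℝ] F} (hβ : HasFDerivAt (oneFormInChart I β n) β' (extChartAt I n n))
    (u v : TangentSpace I n) :
    extDerivOneForm I β n ![u, v] =
      β' (mfderiv I 𝓘(ℝ, E) (extChartAt I n) n u) (mfderiv I 𝓘(ℝ, E) (extChartAt I n) n v) -
      β' (mfderiv I 𝓘(ℝ, E) (extChartAt I n) n v) (mfderiv I 𝓘(ℝ, E) (extChartAt I n) n u) := by
  have h1 : HasFDerivAt (fun y ↦ ContinuousAlternatingMap.ofSubsingleton ℝ E F (0 : Fin 1)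
      (oneFormInChart I β n y)) _ (extChartAt I n n) :=
    ((ContinuousAlternatingMap.ofSubsingletonLIE (𝕜 := ℝ) (E := E) (F := F)
      (0 : Fin 1)).toContinuousLinearEquiv.toContinuousLinearMap.hasFDerivAt).comp _ hβ
  unfold extDerivOneForm
  rw [I.range_eq_univ, extDerivWithin_univ]
  have h2 : (fun y : E ↦ ContinuousAlternatingMap.ofSubsingleton ℝ E F (0 : Fin 1)
        ((β ((extChartAt I n).symm y)).comp
          (mfderivWithin 𝓘(ℝ, E) I (extChartAt I n).symm univ y))) =
      fun y ↦ ContinuousAlternatingMap.ofSubsingleton ℝ E F (0 : Fin 1)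
      (oneFormInChart I β n y) := by
    unfold oneFormInChart
    rw [I.range_eq_univ]
  rw [h2, extDeriv, h1.fderiv]
  have key : ∀ (A : E →L[ℝ] E) (u v : E), (ContinuousAlternatingMap.alternatizeUncurryFin
      (((ContinuousAlternatingMap.ofSubsingletonLIE (𝕜 := ℝ) (E := E) (F := F)
        (0 : Fin 1)).toContinuousLinearEquiv.toContinuousLinearMap).comp
          β')).compContinuousLinearMap A ![u, v] = β' (A u) (A v) - β' (A v) (A u) := by
    intro A u v
    rw [ContinuousAlternatingMap.compContinuousLinearMap_apply,
      ContinuousAlternatingMap.alternatizeUncurryFin_apply, Fin.sum_univ_two]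
    simp only [Fin.val_zero, pow_zero, one_smul, Fin.val_one, pow_one, neg_smul, sub_eq_add_neg]
    rfl
  exact key _ u v

/-- Near `n` the inverse of the tangent trivialization is the derivative of the inverse chart, so
the chart reading is the trivialized form composed with the inverse chart. -/
theorem mdifferentiableAt_oneFormInChart [I.Boundaryless] [IsManifold I ∞ N]
   {β : ∀ x : N, TangentSpace I x →L[ℝ] F} {n : N}
    (hβ : MDifferentiableAt I 𝓘(ℝ, E →L[ℝ] F)
      (fun x ↦ (β x).comp ((trivializationAt E (TangentSpace I) n).symmL ℝ x)) n) :
    DifferentiableAt ℝ (oneFormInChart I β n) (extChartAt I n n) := by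
  have hs : MDifferentiableAt 𝓘(ℝ, E) I (extChartAt I n).symm (extChartAt I n n) :=
    (mdifferentiableWithinAt_extChartAt_symm (mem_extChartAt_target n)).mdifferentiableAt
      (by rw [I.range_eq_univ]; exact Filter.univ_mem)
  have h0 : (extChartAt I n).symm (extChartAt I n n) = n := extChartAt_to_inv n
  rw [← h0] at hβ
  have h1 := (MDifferentiableAt.comp (extChartAt I n n) hβ hs).differentiableAt
  rw [h0] at h1
  refine h1.congr_of_eventuallyEq ?_
  filter_upwards [extChartAt_target_mem_nhds (I := I) n] with y hy
  have hy' : (extChartAt I n).symm y ∈ (chartAt H n).source := by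
    rw [← extChartAt_source I]; exact (extChartAt I n).map_target hy
  simp only [Function.comp_apply, oneFormInChart]
  rw [TangentBundle.symmL_trivializationAt hy', (extChartAt I n).right_inv hy]

/-- A 1-form is evaluated in the preferred chart. -/
theorem oneFormInChart_apply [IsManifold I ∞ N] {β : ∀ x : N, TangentSpace I x →L[ℝ] F} {n x : N}
    (hx : x ∈ (extChartAt I n).source) (v : TangentSpace I x) :
    oneFormInChart I β n (extChartAt I n x) (mfderiv I 𝓘(ℝ, E) (extChartAt I n) x v) = β x v := by
  have h := congrArg (fun A ↦ A v) (mfderivWithin_extChartAt_symm_comp_mfderiv_extChartAt' hx)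
  have h' : (mfderivWithin 𝓘(ℝ, E) I (extChartAt I n).symm (range I) (extChartAt I n x))
    (mfderiv I 𝓘(ℝ, E) (extChartAt I n) x v) = v := h
  have h0 := (extChartAt I n).left_inv hx
  change β ((extChartAt I n).symm (extChartAt I n x)) (_ : E) = _
  erw [h']
  -- The chart round trip returns `x` only up to a propositional equality, on which the fibre
  -- depends; generalizing the point allows substitution.
  generalize (extChartAt I n).symm (extChartAt I n x) = x' at h0
  subst h0
  rfl

/-- A straight line in the chart works, because the inverse chart has identity derivative at the
base point. Such curves reduce later identities to one-variable calculus. -/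
theorem exists_curve [I.Boundaryless] [IsManifold I ∞ N] (n : N) (v : TangentSpace I n) :
    ∃ γ : ℝ → N, γ 0 = n ∧ ContMDiffAt 𝓘(ℝ, ℝ) I ∞ γ 0 ∧
      (mfderiv 𝓘(ℝ, ℝ) I γ 0 (1 : ℝ) : E) = v := by
  obtain ⟨v', hv'⟩ : ∃ v' : E, v' = v := ⟨v, rfl⟩
  rw [← hv']
  let l : ℝ → E := fun t ↦ extChartAt I n n + t • v'
  have hl0 : l 0 = extChartAt I n n := by simp [l]
  have hl : HasDerivAt l v' 0 := by
    simpa [l] using ((hasDerivAt_id (0 : ℝ)).smul_const v').const_add (extChartAt I n n)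
  have hlm : ContMDiffAt 𝓘(ℝ, ℝ) 𝓘(ℝ, E) ∞ l 0 :=
    ContDiffAt.contMDiffAt (by fun_prop)
  have hs : ContMDiffAt 𝓘(ℝ, E) I ∞ (extChartAt I n).symm (l 0) := by
    rw [hl0]
    exact (contMDiffOn_extChartAt_symm n).contMDiffAt (extChartAt_target_mem_nhds n)
  refine ⟨(extChartAt I n).symm ∘ l, ?_, hs.comp 0 hlm, ?_⟩
  · simp [hl0]
  · rw [mfderiv_comp 0 (hs.mdifferentiableAt (by simp)) (hlm.mdifferentiableAt (by simp))]
    have h1 : mfderiv 𝓘(ℝ, ℝ) 𝓘(ℝ, E) l 0 (1 : ℝ) = v' := by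
      rw [mfderiv_eq_fderiv]
      exact hl.deriv
    have h2 : mfderiv 𝓘(ℝ, E) I (extChartAt I n).symm (l 0) = ContinuousLinearMap.id ℝ E := by
      have h3 := mfderivWithin_range_extChartAt_symm (I := I) (x := n)
      rw [I.range_eq_univ, mfderivWithin_univ] at h3
      rw [hl0]
      exact h3
    change mfderiv 𝓘(ℝ, E) I (extChartAt I n).symm (l 0) _ = _
    erw [h1, h2]
    rfl

/-- In the chart each mixed derivative is a term in the derivative of `β` plus `β` on the mixed
second derivative of `c`. The latter cancel, so neither extensions to vector fields nor Lie brackets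
are needed. -/
theorem extDerivOneForm_twoParameter [I.Boundaryless] [IsManifold I ∞ N]
    {β : ∀ x : N, TangentSpace I x →L[ℝ] F}
    {c : ℝ × ℝ → N} {n : N} (hn : c 0 = n) (hβ : MDifferentiableAt I 𝓘(ℝ, E →L[ℝ] F)
      (fun x ↦ (β x).comp ((trivializationAt E (TangentSpace I) n).symmL ℝ x)) n)
    (hc : ContMDiffAt 𝓘(ℝ, ℝ × ℝ) I 2 c 0) (a b : ℝ × ℝ) {u v : TangentSpace I n}
    (hu : (mfderiv 𝓘(ℝ, ℝ × ℝ) I c 0 a : E) = u) (hv : (mfderiv 𝓘(ℝ, ℝ × ℝ) I c 0 b : E) = v) :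
    ∃ d₁ d₂ : F,
      HasDerivAt (fun s : ℝ ↦ β (c (s • a)) (mfderiv 𝓘(ℝ, ℝ × ℝ) I c (s • a) b)) d₁ 0 ∧
      HasDerivAt (fun s : ℝ ↦ β (c (s • b)) (mfderiv 𝓘(ℝ, ℝ × ℝ) I c (s • b) a)) d₂ 0 ∧
      extDerivOneForm I β n ![u, v] = d₁ - d₂ := by
  subst hn
  subst hu hv
  have hψ : ContMDiffAt I 𝓘(ℝ, E) 2 (extChartAt I (c 0)) (c 0) :=
    contMDiffAt_extChartAt.of_le (n := ∞) (WithTop.coe_le_coe.2 le_top)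
  set F' : ℝ × ℝ → E := extChartAt I (c 0) ∘ c with hF'
  have hF : ContDiffAt ℝ 2 F' 0 := (hψ.comp 0 hc).contDiffAt
  have hev : ∀ᶠ x in 𝓝 (0 : ℝ × ℝ), ∀ w : ℝ × ℝ,
      oneFormInChart I β (c 0) (F' x) (fderiv ℝ F' x w) =
        β (c x) (mfderiv 𝓘(ℝ, ℝ × ℝ) I c x w) := by
    filter_upwards [hc.continuousAt (extChartAt_source_mem_nhds (I := I) (c 0)),
      (contMDiffAt_iff_contMDiffAt_nhds (by simp)).1 hc] with x hx hcx w
    have hx' : c x ∈ (chartAt H (c 0)).source := by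
      rw [← extChartAt_source I]; exact hx
    have h1 : fderiv ℝ F' x w = mfderiv I 𝓘(ℝ, E) (extChartAt I (c 0)) (c x)
        (mfderiv 𝓘(ℝ, ℝ × ℝ) I c x w) := by
      rw [← mfderiv_eq_fderiv, hF', mfderiv_comp x (mdifferentiableAt_extChartAt hx')
        (hcx.mdifferentiableAt (by norm_num))]
      rfl
    rw [h1]
    exact oneFormInChart_apply hx _
  have hβ' := (mdifferentiableAt_oneFormInChart hβ).hasFDerivAt
  have hline : ∀ w : ℝ × ℝ, Filter.Tendsto (fun s : ℝ ↦ s • w) (𝓝 0) (𝓝 0) := fun w ↦ by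
    have h : Continuous fun s : ℝ ↦ s • w := by fun_prop
    simpa using h.tendsto 0
  refine ⟨_, _, (hasDerivAt_oneForm_fderiv (a := a) (b := b) hβ' hF).congr_of_eventuallyEq ?_,
    (hasDerivAt_oneForm_fderiv (a := b) (b := a) hβ' hF).congr_of_eventuallyEq ?_, ?_⟩
  · filter_upwards [(hline a).eventually hev] with s hs
    exact (hs b).symm
  · filter_upwards [(hline b).eventually hev] with s hs
    exact (hs a).symm
  · rw [extDerivOneForm_apply hβ', fderiv_fderiv_comm hF a b, add_sub_add_right_eq_sub]
    have h1 : ∀ w : ℝ × ℝ, fderiv ℝ F' 0 w = mfderiv I 𝓘(ℝ, E) (extChartAt I (c 0)) (c 0)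
        (mfderiv 𝓘(ℝ, ℝ × ℝ) I c 0 w) := fun w ↦ by
      rw [← mfderiv_eq_fderiv, hF', mfderiv_comp 0
        (hψ.mdifferentiableAt (by norm_num)) (hc.mdifferentiableAt (by norm_num))]
      rfl
    rw [h1, h1]

theorem mfderiv_apply_of_comp_line [IsManifold I ∞ N] {c : ℝ × ℝ → N} {x b : ℝ × ℝ}
    (hc : MDifferentiableAt 𝓘(ℝ, ℝ × ℝ) I c x) {γ : ℝ → N} (hγ : ∀ t, c (x + t • b) = γ t) :
    (mfderiv 𝓘(ℝ, ℝ × ℝ) I c x b : E) = mfderiv 𝓘(ℝ, ℝ) I γ 0 (1 : ℝ) := by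
  have hl : HasDerivAt (fun t : ℝ ↦ x + t • b) b 0 := by
    simpa using ((hasDerivAt_id (0 : ℝ)).smul_const b).const_add x
  have hx : x + (0 : ℝ) • b = x := by simp
  have hγ' : γ = c ∘ fun t : ℝ ↦ x + t • b := funext fun t ↦ (hγ t).symm
  rw [← hx] at hc
  rw [hγ', mfderiv_comp 0 hc hl.differentiableAt.mdifferentiableAt]
  have h1 : mfderiv 𝓘(ℝ, ℝ) 𝓘(ℝ, ℝ × ℝ) (fun t : ℝ ↦ x + t • b) 0 (1 : ℝ) = b := by
    rw [mfderiv_eq_fderiv]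
    exact hl.deriv
  change _ = mfderiv 𝓘(ℝ, ℝ × ℝ) I c (x + (0 : ℝ) • b) _
  erw [h1]
  rw [hx]

/-- **Cartan's formula for an invariant 1-form**: if the 1-form `β` is invariant, on the tangent
vector `v` at `n`, under the transformations `Φ p` of `N`, and `Φ p₀ = id`, then
`dβ(η_N, v) = -d(β(η_N))(v)`, where `η_N` is the infinitesimal generator of `η ∈ T_{p₀}P`. -/
theorem extDerivOneForm_generator [I.Boundaryless] [IsManifold I ∞ N] {EP HP P : Type*}
    [NormedAddCommGroup EP]
    [NormedSpace ℝ EP] [TopologicalSpace HP] {IP : ModelWithCorners ℝ EP HP} [IP.Boundaryless]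
    [TopologicalSpace P] [ChartedSpace HP P] [IsManifold IP ∞ P]
    {β : ∀ x : N, TangentSpace I x →L[ℝ] F} {Φ : P → N → N} {p₀ : P} {n : N}
    (hβ : MDifferentiableAt I 𝓘(ℝ, E →L[ℝ] F)
      (fun x ↦ (β x).comp ((trivializationAt E (TangentSpace I) n).symmL ℝ x)) n)
    (hΦ : ContMDiff (IP.prod I) I ∞ (Function.uncurry Φ)) (hid : ∀ x, Φ p₀ x = x)
    {v : TangentSpace I n} (hinv : ∀ p, β (Φ p n) (mfderiv I I (Φ p) n v) = β n v)
    {η : TangentSpace IP p₀} {h : N → F}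
    (hh : ∀ x, h x = β (Φ p₀ x) (mfderiv IP I (fun p ↦ Φ p x) p₀ η))
    (hdh : MDifferentiableAt I 𝓘(ℝ, F) h n) {u : TangentSpace I n}
    (hu : (mfderiv IP I (fun p ↦ Φ p n) p₀ η : E) = u) :
    extDerivOneForm I β n ![u, v] = -(mfderiv I 𝓘(ℝ, F) h n v : F) := by
  obtain ⟨p, rfl, hp, hpη⟩ := exists_curve p₀ η
  obtain ⟨γ, rfl, hγ, hγv⟩ := exists_curve n v
  -- The first parameter moves the transformation with velocity `η`, the second moves the point with
  -- velocity `v`.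
  let c : ℝ × ℝ → N := fun x ↦ Φ (p x.1) (γ x.2)
  have hΦ₁ : ∀ q, ContMDiff I I ∞ (Φ q) := fun q ↦ hΦ.comp (contMDiff_const.prodMk contMDiff_id)
  have hΦ₂ : ∀ x, ContMDiff IP I ∞ fun q ↦ Φ q x :=
    fun x ↦ hΦ.comp (contMDiff_id.prodMk contMDiff_const)
  have hc0 : c 0 = γ 0 := hid _
  have hc : ContMDiffAt 𝓘(ℝ, ℝ × ℝ) I 2 c 0 := by
    have h1 : ContMDiffAt 𝓘(ℝ, ℝ × ℝ) IP ∞ (fun x : ℝ × ℝ ↦ p x.1) 0 :=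
      ContMDiffAt.comp (0 : ℝ × ℝ) (g := p) (f := Prod.fst) hp contDiff_fst.contDiffAt.contMDiffAt
    have h2 : ContMDiffAt 𝓘(ℝ, ℝ × ℝ) I ∞ (fun x : ℝ × ℝ ↦ γ x.2) 0 :=
      ContMDiffAt.comp (0 : ℝ × ℝ) (g := γ) (f := Prod.snd) hγ contDiff_snd.contDiffAt.contMDiffAt
    exact (hΦ.contMDiffAt.comp (0 : ℝ × ℝ) (h1.prodMk h2)).of_le (WithTop.coe_le_coe.2 le_top)
  have hcd : ∀ᶠ x in 𝓝 (0 : ℝ × ℝ), MDifferentiableAt 𝓘(ℝ, ℝ × ℝ) I c x :=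
    ((contMDiffAt_iff_contMDiffAt_nhds (by simp)).1 hc).mono fun x hx ↦ hx.mdifferentiableAt
        (by norm_num)
  have hline : ∀ w : ℝ × ℝ, Filter.Tendsto (fun s : ℝ ↦ s • w) (𝓝 0) (𝓝 0) := fun w ↦ by
    have h : Continuous fun s : ℝ ↦ s • w := by fun_prop
    simpa using h.tendsto 0
  have hb : ∀ s : ℝ, MDifferentiableAt 𝓘(ℝ, ℝ × ℝ) I c (s • ((1, 0) : ℝ × ℝ)) →
      (mfderiv 𝓘(ℝ, ℝ × ℝ) I c (s • ((1, 0) : ℝ × ℝ)) ((0, 1) : ℝ × ℝ) : E) =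
        mfderiv I I (Φ (p s)) (γ 0) v := by
    intro s hs
    rw [mfderiv_apply_of_comp_line hs (γ := Φ (p s) ∘ γ) (fun t ↦ by simp [c]),
      mfderiv_comp 0 ((hΦ₁ _).mdifferentiableAt (by simp)) (hγ.mdifferentiableAt (by simp))]
    exact congrArg (mfderiv I I (Φ (p s)) (γ 0)) hγv
  have ha : ∀ t : ℝ, MDifferentiableAt 𝓘(ℝ, ℝ × ℝ) I c (t • ((0, 1) : ℝ × ℝ)) →
      (mfderiv 𝓘(ℝ, ℝ × ℝ) I c (t • ((0, 1) : ℝ × ℝ)) ((1, 0) : ℝ × ℝ) : E) =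
        mfderiv IP I (fun q ↦ Φ q (γ t)) (p 0) η := by
    intro t ht
    rw [mfderiv_apply_of_comp_line ht (γ := (fun q ↦ Φ q (γ t)) ∘ p) (fun s ↦ by simp [c]),
      mfderiv_comp 0 ((hΦ₂ _).mdifferentiableAt (by simp)) (hp.mdifferentiableAt (by simp))]
    exact congrArg (mfderiv IP I (fun q ↦ Φ q (γ t)) (p 0)) hpη
  have hc0d := hcd.self_of_nhds
  have hbv : (mfderiv 𝓘(ℝ, ℝ × ℝ) I c 0 ((0, 1) : ℝ × ℝ) : E) = v := by
    have h1 := mfderiv_apply_of_comp_line hc0d (b := ((0, 1) : ℝ × ℝ)) (γ := γ)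
      (fun t ↦ by simp [c, hid])
    exact h1.trans hγv
  have hau : (mfderiv 𝓘(ℝ, ℝ × ℝ) I c 0 ((1, 0) : ℝ × ℝ) : E) = u := by
    have h1 := ha 0 (by simpa using hc0d)
    rw [zero_smul] at h1
    exact h1.trans hu
  obtain ⟨d₁, d₂, h₁, h₂, hd⟩ := extDerivOneForm_twoParameter hc0 hβ hc (1, 0) (0, 1) hau hbv
  -- On the first axis the velocity in the second parameter is the image of `v` under `Φ (p s)`, so
  -- invariance makes the function constant.
  have e₁ : d₁ = 0 := by
    refine h₁.unique ((hasDerivAt_const (0 : ℝ) (β (γ 0) v)).congr_of_eventuallyEq ?_)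
    filter_upwards [(hline (1, 0)).eventually hcd] with s hs
    have h3 : c (s • ((1, 0) : ℝ × ℝ)) = Φ (p s) (γ 0) := by simp [c]
    rw [← hinv (p s)]
    have h4 := hb s hs
    have key : ∀ (x y : N) (a : TangentSpace I x) (b : TangentSpace I y), x = y →
        (a : E) = (b : E) → β x a = β y b := by
      rintro x _ a b rfl hab
      exact congrArg (β x) hab
    exact key _ _ _ _ h3 h4
  -- On the second axis the transformation is the identity, and `β` on the velocity in the first
  -- parameter is `h ∘ γ`.
  have e₂ : d₂ = mfderiv I 𝓘(ℝ, F) h (γ 0) v := by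
    have h3 : HasDerivAt (h ∘ γ) (mfderiv I 𝓘(ℝ, F) h (γ 0) v : F) 0 := by
      have h4 := (hdh.hasMFDerivAt.comp 0 (hγ.mdifferentiableAt (by simp)).hasMFDerivAt)
      have h5 : ∀ L : ℝ →L[ℝ] F, HasFDerivAt (h ∘ γ) L 0 → HasDerivAt (h ∘ γ) (L 1) 0 :=
        fun L hL ↦ hL.hasDerivAt
      exact (h5 _ h4.hasFDerivAt).congr_deriv (congrArg (mfderiv I 𝓘(ℝ, F) h (γ 0)) hγv)
    refine h₂.unique (h3.congr_of_eventuallyEq ?_)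
    filter_upwards [(hline (0, 1)).eventually hcd] with t ht
    have h3 : c (t • ((0, 1) : ℝ × ℝ)) = Φ (p 0) (γ t) := by simp [c]
    have h4 := ha t ht
    have key : ∀ (x y : N) (a : TangentSpace I x) (b : TangentSpace I y), x = y →
        (a : E) = (b : E) → β x a = β y b := by
      rintro x _ a b rfl hab
      exact congrArg (β x) hab
    rw [Function.comp_apply, hh]
    exact key _ _ _ _ h3 h4
  rw [hd, e₁, e₂]
  exact zero_sub (_ : F)

end ExtDeriv

theorem symmL_trivializationAt_self {E H N : Type*} [NormedAddCommGroup E] [NormedSpace ℝ E]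
    [TopologicalSpace H] {I : ModelWithCorners ℝ E H} [TopologicalSpace N]
    [ChartedSpace H N] [IsManifold I 1 N] (n : N) :
    ((trivializationAt E (TangentSpace I) n).symmL ℝ n : E →L[ℝ] E) =
      ContinuousLinearMap.id ℝ E := by
  rw [TangentBundle.symmL_trivializationAt (mem_chart_source H n)]
  exact mfderivWithin_range_extChartAt_symm

theorem oneForm_congr {E H N F : Type*} [NormedAddCommGroup E] [NormedSpace ℝ E]
    [TopologicalSpace H] {I : ModelWithCorners ℝ E H} [TopologicalSpace N]
    [ChartedSpace H N] [NormedAddCommGroup F] [NormedSpace ℝ F]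
    (β : ∀ x : N, TangentSpace I x →L[ℝ] F) {x y : N} {a : TangentSpace I x}
    {b : TangentSpace I y} (hxy : x = y) (hab : (a : E) = (b : E)) : β x a = β y b := by
  subst hxy
  exact congrArg (β x) hab

/-! ### Smoothness of the infinitesimal generators. -/

section Generator

variable {E : Type*} [NormedAddCommGroup E] [NormedSpace ℝ E]
  {Q : Type*} [TopologicalSpace Q] [ChartedSpace E Q] [IsManifold 𝓘(ℝ, E) ∞ Q]
  (EG : Type*) [NormedAddCommGroup EG] [NormedSpace ℝ EG]
  (G : Type*) [TopologicalSpace G] [ChartedSpace EG G] [Group G] [LieGroup 𝓘(ℝ, EG) ∞ G]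
  [MulAction G Q] [ContMDiffSMul 𝓘(ℝ, EG) 𝓘(ℝ, E) ∞ G Q]

/-- The infinitesimal generator map at `q`, read in the trivialization of `TQ` at `q₀`. -/
def generatorInTriv (q₀ q : Q) : EG →L[ℝ] E :=
  ((trivializationAt E (TangentSpace 𝓘(ℝ, E)) q₀).continuousLinearMapAt ℝ q).comp
    (generator E EG G q)

/-- The derivative of `g ↦ g • q` at `1` depends smoothly on the parameter `q`, because the action
is jointly smooth; the trivialization of the Lie algebra at `1` is the identity. -/
theorem contMDiffAt_generatorInTriv (q₀ : Q) :
    ContMDiffAt 𝓘(ℝ, E) 𝓘(ℝ, EG →L[ℝ] E) ∞ (generatorInTriv (E := E) EG G q₀) q₀ := by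
  have h := ContMDiffAt.mfderiv (n := ∞) (m := ∞) (I := 𝓘(ℝ, EG)) (I' := 𝓘(ℝ, E))
    (J := 𝓘(ℝ, E)) (x₀ := q₀) (fun (q : Q) (g : G) ↦ g • q) (fun _ ↦ (1 : G))
    (((contMDiff_snd (I := 𝓘(ℝ, E)) (J := 𝓘(ℝ, EG)) (M := Q) (N := G)).smul
      contMDiff_fst).contMDiffAt) contMDiffAt_const (by simp)
  have h1 : (fun q : Q ↦ (1 : G) • q) = fun q ↦ q := by ext; simp
  rw [h1] at h
  convert! h using 1
  ext q v
  have h3 : ((trivializationAt EG (TangentSpace 𝓘(ℝ, EG)) (1 : G)).symmL ℝ (1 : G)) v = v :=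
    congrArg (fun A : EG →L[ℝ] EG ↦ A v) (symmL_trivializationAt_self (I := 𝓘(ℝ, EG)) (1 : G))
  change _ = (trivializationAt E (TangentSpace 𝓘(ℝ, E)) q₀).continuousLinearMapAt ℝ q
    (generator E EG G q
      (((trivializationAt EG (TangentSpace 𝓘(ℝ, EG)) (1 : G)).symmL ℝ (1 : G)) v))
  rw [h3]
  rfl

end Generator

/-! ### The canonical form, the momentum map and the lifted action on `T*Q`. -/

section Cotangent

variable {E : Type*} [NormedAddCommGroup E] [NormedSpace ℝ E]
  {Q : Type*} [TopologicalSpace Q] [ChartedSpace E Q] [IsManifold 𝓘(ℝ, E) ∞ Q]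
  {EG : Type*} [NormedAddCommGroup EG] [NormedSpace ℝ EG]
  {G : Type*} [TopologicalSpace G] [ChartedSpace EG G] [Group G] [LieGroup 𝓘(ℝ, EG) ∞ G]
  [MulAction G Q] [ContMDiffSMul 𝓘(ℝ, EG) 𝓘(ℝ, E) ∞ G Q]

theorem contMDiff_cotangent_proj :
    ContMDiff (cotangentModel E) 𝓘(ℝ, E) ∞ (fun α : Cotangent E Q ↦ α.proj) :=
  contMDiff_proj _

/-- The fibre coordinate of a covector in the trivialization at `q₀`. -/
def fibreCoord (q₀ : Q) (α : Cotangent E Q) : E →L[ℝ] ℝ :=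
  α.2.comp ((trivializationAt E (TangentSpace 𝓘(ℝ, E)) q₀).symmL ℝ α.proj)

theorem inCoordinates_eq_fibreCoord (q₀ q : Q) (α : TangentSpace 𝓘(ℝ, E) q →L[ℝ] ℝ) :
    ContinuousLinearMap.inCoordinates E (fun q : Q ↦ TangentSpace 𝓘(ℝ, E) q) ℝ (fun _ : Q ↦ ℝ)
      q₀ q q₀ q α = fibreCoord q₀ ⟨q, α⟩ := by
  ext v
  simp [ContinuousLinearMap.inCoordinates, fibreCoord]

theorem contMDiffAt_cotangent_iff {E' H' M : Type*} [NormedAddCommGroup E'] [NormedSpace ℝ E']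
    [TopologicalSpace H'] {I' : ModelWithCorners ℝ E' H'} [TopologicalSpace M]
    [ChartedSpace H' M] {f : M → Cotangent E Q} {x₀ : M} :
    ContMDiffAt I' (cotangentModel E) ∞ f x₀ ↔
      ContMDiffAt I' 𝓘(ℝ, E) ∞ (fun x ↦ (f x).proj) x₀ ∧
      ContMDiffAt I' 𝓘(ℝ, E →L[ℝ] ℝ) ∞ (fun x ↦ fibreCoord (f x₀).proj (f x)) x₀ := by
  rw [contMDiffAt_hom_bundle]
  simp only [inCoordinates_eq_fibreCoord]

theorem contMDiffAt_fibreCoord (α₀ : Cotangent E Q) :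
    ContMDiffAt (cotangentModel E) 𝓘(ℝ, E →L[ℝ] ℝ) ∞ (fibreCoord α₀.proj) α₀ :=
  (contMDiffAt_cotangent_iff.1 (contMDiffAt_id (I := cotangentModel E) (x := α₀))).2

/-- The canonical momentum map `α ↦ α ∘ Ψ_q` of `T*Q`. -/
def cotangentMomentum (EG : Type*) [NormedAddCommGroup EG] [NormedSpace ℝ EG]
    (G : Type*) [TopologicalSpace G] [ChartedSpace EG G] [Group G] [MulAction G Q]
    (α : Cotangent E Q) : EG →L[ℝ] ℝ :=
  α.2.comp (generator E EG G α.proj)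

variable (EG G) in
-- Inserting the trivialization of `TQ` and its inverse between the covector and the generator gives
-- a product of two smooth local expressions. The same insertion serves for `Θ_Q`, the lifted action
-- and the connection forms.
theorem contMDiff_cotangentMomentum :
    ContMDiff (cotangentModel E) 𝓘(ℝ, EG →L[ℝ] ℝ) ∞
      (cotangentMomentum EG G : Cotangent E Q → _) := by
  intro α₀
  have h1 := (contMDiffAt_fibreCoord α₀).clm_comp
    ((contMDiffAt_generatorInTriv
        (E := E) EG G α₀.proj).comp α₀ contMDiff_cotangent_proj.contMDiffAt)
  refine h1.congr_of_eventuallyEq ?_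
  filter_upwards [contMDiff_cotangent_proj.continuous.continuousAt.preimage_mem_nhds
    (chart_source_mem_nhds E α₀.proj)] with α hα
  ext v
  exact congrArg α.2
      ((trivializationAt E (TangentSpace 𝓘(ℝ, E)) α₀.proj).symmL_continuousLinearMapAt
    (R := ℝ) hα _).symm

theorem mdifferentiableAt_canonicalOneForm (α₀ : Cotangent E Q) :
    MDifferentiableAt (cotangentModel E) 𝓘(ℝ, (E × (E →L[ℝ] ℝ)) →L[ℝ] ℝ)
      (fun α ↦ (canonicalOneForm α).comp
        ((trivializationAt (E × (E →L[ℝ] ℝ)) (TangentSpace (cotangentModel E)) α₀).symmL ℝ α))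
      α₀ := by
  have h0 := ContMDiffAt.mfderiv_const (m := ∞) (n := ∞)
    (contMDiff_cotangent_proj (E := E) (Q := Q) α₀) (by simp)
  have h1 := (contMDiffAt_fibreCoord α₀).clm_comp h0
  refine (h1.congr_of_eventuallyEq ?_).mdifferentiableAt (by simp)
  filter_upwards [contMDiff_cotangent_proj.continuous.continuousAt.preimage_mem_nhds
    (chart_source_mem_nhds E α₀.proj)] with α hα
  refine ContinuousLinearMap.ext fun v ↦ ?_
  exact congrArg α.2
      ((trivializationAt E (TangentSpace 𝓘(ℝ, E)) α₀.proj).symmL_continuousLinearMapAt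
    (R := ℝ) hα _).symm

theorem cotangentLift_one {E Q G : Type*} [NormedAddCommGroup E] [NormedSpace ℝ E]
    [TopologicalSpace Q] [ChartedSpace E Q] [IsManifold 𝓘(ℝ, E) ∞ Q] [Group G] [MulAction G Q]
    (α : Cotangent E Q) :
    System.cotangentLift (1 : G) α = α := by
  -- The map is generalized because the action of `1` is only propositionally the identity, and the
  -- covector's fibre depends on it.
  have key : ∀ f : Q → Q, f = id → (⟨f α.proj,
      α.2.comp (mfderiv 𝓘(ℝ, E) 𝓘(ℝ, E) f α.proj).inverse⟩ : Cotangent E Q) = α := by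
    rintro f rfl
    rw [mfderiv_id, ContinuousLinearMap.inverse_id]
    rfl
  exact key _ (by ext; simp)

theorem exists_mfderiv_smul_equiv {E Q : Type*} [NormedAddCommGroup E] [NormedSpace ℝ E]
    [TopologicalSpace Q] [ChartedSpace E Q] (EG : Type*) [NormedAddCommGroup EG] [NormedSpace ℝ EG]
    {G : Type*} [TopologicalSpace G] [ChartedSpace EG G] [Group G] [LieGroup 𝓘(ℝ, EG) ∞ G]
    [MulAction G Q] [ContMDiffSMul 𝓘(ℝ, EG) 𝓘(ℝ, E) ∞ G Q] (g : G) (q : Q) :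
    ∃ A : TangentSpace 𝓘(ℝ, E) q ≃L[ℝ] TangentSpace 𝓘(ℝ, E) (g • q),
      mfderiv 𝓘(ℝ, E) 𝓘(ℝ, E) (fun p : Q ↦ g • p) q = A :=
  ⟨(Diffeomorph.smul 𝓘(ℝ, EG) 𝓘(ℝ, E) ∞ g).mfderivToContinuousLinearEquiv (by simp) q, rfl⟩

/-- Replacing the inverse operator by the derivative of the action of `g⁻¹` makes the cotangent lift
a parametric derivative of a smooth map, from which its joint smoothness follows. -/
theorem mfderiv_smul_inverse (EG : Type*) [NormedAddCommGroup EG] [NormedSpace ℝ EG]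
    {G : Type*} [TopologicalSpace G] [ChartedSpace EG G] [Group G] [LieGroup 𝓘(ℝ, EG) ∞ G]
    [MulAction G Q] [ContMDiffSMul 𝓘(ℝ, EG) 𝓘(ℝ, E) ∞ G Q] (g : G) (q : Q)
    (v : TangentSpace 𝓘(ℝ, E) (g • q)) :
    (mfderiv 𝓘(ℝ, E) 𝓘(ℝ, E) (fun p : Q ↦ g • p) q).inverse v =
      (mfderiv 𝓘(ℝ, E) 𝓘(ℝ, E) (fun p : Q ↦ g⁻¹ • p) (g • q) v : E) := by
  obtain ⟨A, hA⟩ := exists_mfderiv_smul_equiv (E := E) EG g q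
  have hs : ∀ g : G, MDifferentiable 𝓘(ℝ, E) 𝓘(ℝ, E) (fun p : Q ↦ g • p) := fun g ↦
    (Diffeomorph.smul 𝓘(ℝ, EG) 𝓘(ℝ, E) ∞ g).contMDiff.mdifferentiable (by simp)
  have h1 := mfderiv_comp q (hs g⁻¹ (g • q)) (hs g q)
  have h2 : (fun p : Q ↦ g⁻¹ • p) ∘ (fun p : Q ↦ g • p) = id := by ext; simp
  rw [h2, mfderiv_id, hA] at h1
  rw [hA, ContinuousLinearMap.inverse_equiv]
  obtain ⟨x, rfl⟩ := A.surjective v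
  refine (A.symm_apply_apply x).trans ?_
  exact congrArg (fun B : E →L[ℝ] E ↦ B x) h1

variable (E Q EG G) in
theorem contMDiff_cotangentLift :
    ContMDiff (𝓘(ℝ, EG).prod (cotangentModel E)) (cotangentModel E) ∞
      (Function.uncurry (System.cotangentLift : G → Cotangent E Q → Cotangent E Q)) := by
  intro p₀
  have hπ : ContMDiff (𝓘(ℝ, EG).prod (cotangentModel E)) 𝓘(ℝ, E) ∞
      (fun p : G × Cotangent E Q ↦ p.2.proj) := contMDiff_cotangent_proj.comp contMDiff_snd
  have hb : ContMDiff (𝓘(ℝ, EG).prod (cotangentModel E)) 𝓘(ℝ, E) ∞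
      (fun p : G × Cotangent E Q ↦ p.1 • p.2.proj) := contMDiff_fst.smul hπ
  refine contMDiffAt_cotangent_iff.2 ⟨hb p₀, ?_⟩
  have h := ContMDiffAt.mfderiv (n := ∞) (m := ∞) (I := 𝓘(ℝ, E)) (I' := 𝓘(ℝ, E)) (x₀ := p₀)
    (fun (p : G × Cotangent E Q) (q : Q) ↦ p.1⁻¹ • q) (fun p ↦ p.1 • p.2.proj)
    (((contMDiff_fst.comp contMDiff_fst).inv.smul contMDiff_snd).contMDiffAt) (hb p₀) (by simp)
  have h1 : (fun p : G × Cotangent E Q ↦ p.1⁻¹ • p.1 • p.2.proj) = fun p ↦ p.2.proj := by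
    ext; simp
  rw [h1] at h
  have h2 := ((contMDiffAt_fibreCoord p₀.2).comp p₀ contMDiffAt_snd).clm_comp h
  refine h2.congr_of_eventuallyEq ?_
  filter_upwards [hπ.continuous.continuousAt.preimage_mem_nhds
    (chart_source_mem_nhds E p₀.2.proj)] with p hp
  ext v
  have h3 := (trivializationAt E (TangentSpace 𝓘(ℝ, E)) p₀.2.proj).symmL_continuousLinearMapAt
    (R := ℝ) hp (mfderiv 𝓘(ℝ, E) 𝓘(ℝ, E) (fun q : Q ↦ p.1⁻¹ • q) (p.1 • p.2.proj)
      ((trivializationAt E (TangentSpace 𝓘(ℝ, E)) (p₀.1 • p₀.2.proj)).symmL ℝ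
        (p.1 • p.2.proj) v) : E)
  refine Eq.trans ?_ (congrArg p.2.2 h3).symm
  exact congrArg p.2.2 (mfderiv_smul_inverse EG p.1 p.2.proj _)

/-- The canonical 1-form is invariant under cotangent lifts. -/
theorem canonicalOneForm_cotangentLift (EG : Type*) [NormedAddCommGroup EG] [NormedSpace ℝ EG]
    {G : Type*} [TopologicalSpace G] [ChartedSpace EG G] [Group G] [LieGroup 𝓘(ℝ, EG) ∞ G]
    [MulAction G Q] [ContMDiffSMul 𝓘(ℝ, EG) 𝓘(ℝ, E) ∞ G Q] (g : G) (α : Cotangent E Q)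
    (v : TangentSpace (cotangentModel E) α) :
    canonicalOneForm (System.cotangentLift g α)
      (mfderiv (cotangentModel E) (cotangentModel E) (System.cotangentLift g) α v) =
      canonicalOneForm α v := by
  have hl : MDifferentiableAt (cotangentModel E) (cotangentModel E)
      (System.cotangentLift g : Cotangent E Q → _) α :=
    ((contMDiff_cotangentLift E Q EG G).comp
      (contMDiff_const.prodMk contMDiff_id)).mdifferentiableAt (by simp)
  have hπ := fun α ↦ (contMDiff_cotangent_proj (E := E) (Q := Q)).mdifferentiableAt
    (x := α) (by simp)
  have hs : MDifferentiable 𝓘(ℝ, E) 𝓘(ℝ, E) (fun p : Q ↦ g • p) :=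
    (Diffeomorph.smul 𝓘(ℝ, EG) 𝓘(ℝ, E) ∞ g).contMDiff.mdifferentiable (by simp)
  have h1 := mfderiv_comp α (hπ (System.cotangentLift g α)) hl
  have h2 := mfderiv_comp α (hs α.proj) (hπ α)
  -- The lift covers the action on `Q`, so the tangent map of `g` met by `Θ_Q` cancels the inverse
  -- in the lifted covector.
  have h3 : (fun β : Cotangent E Q ↦ β.proj) ∘ System.cotangentLift g =
    (fun p : Q ↦ g • p) ∘ fun β : Cotangent E Q ↦ β.proj := rfl
  rw [h3, h2] at h1
  obtain ⟨A, hA⟩ := exists_mfderiv_smul_equiv (E := E) EG g α.proj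
  have h4 : mfderiv (cotangentModel E) 𝓘(ℝ, E) (fun β : Cotangent E Q ↦ β.proj)
      (System.cotangentLift g α)
      (mfderiv (cotangentModel E) (cotangentModel E) (System.cotangentLift g) α v) =
      A (mfderiv (cotangentModel E) 𝓘(ℝ, E) (fun β : Cotangent E Q ↦ β.proj) α v) := by
    rw [hA] at h1
    exact (congrArg (fun B : (E × (E →L[ℝ] ℝ)) →L[ℝ] E ↦ B v) h1).symm
  change α.2 ((mfderiv 𝓘(ℝ, E) 𝓘(ℝ, E) (fun p : Q ↦ g • p) α.proj).inverse
    (mfderiv (cotangentModel E) 𝓘(ℝ, E) (fun β : Cotangent E Q ↦ β.proj)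
      (System.cotangentLift g α) _)) = α.2 _
  rw [h4, hA, ContinuousLinearMap.inverse_equiv]
  exact congrArg α.2 (A.symm_apply_apply _)

/-- `Θ_Q` sees only the projection of a vector to `Q`, and the generator of the lifted action
projects to `η_Q`. -/
theorem canonicalOneForm_generator (α : Cotangent E Q) (η : GroupLieAlgebra 𝓘(ℝ, EG) G) :
    canonicalOneForm (System.cotangentLift (1 : G) α)
      (mfderiv 𝓘(ℝ, EG) (cotangentModel E) (fun g : G ↦ System.cotangentLift g α) 1 η) =
      cotangentMomentum EG G α η := by
  have hl : MDifferentiableAt 𝓘(ℝ, EG) (cotangentModel E)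
      (fun g : G ↦ System.cotangentLift g α) 1 :=
    ((contMDiff_cotangentLift E Q EG G).comp
      (contMDiff_id.prodMk contMDiff_const)).mdifferentiableAt (by simp)
  have hπ := (contMDiff_cotangent_proj (E := E) (Q := Q)).mdifferentiableAt
    (x := System.cotangentLift (1 : G) α) (by simp)
  have h1 := mfderiv_comp (1 : G) hπ hl
  have h2 : mfderiv (cotangentModel E) 𝓘(ℝ, E) (fun β : Cotangent E Q ↦ β.proj)
      (System.cotangentLift (1 : G) α)
      (mfderiv 𝓘(ℝ, EG) (cotangentModel E) (fun g : G ↦ System.cotangentLift g α) 1 η) =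
      generator E EG G α.proj η :=
    (congrArg (fun B : EG →L[ℝ] E ↦ B η) h1).symm
  change (System.cotangentLift (1 : G) α).2 (mfderiv (cotangentModel E) 𝓘(ℝ, E)
    (fun β : Cotangent E Q ↦ β.proj) (System.cotangentLift (1 : G) α) _) = _
  rw [h2]
  have key : ∀ (β : Cotangent E Q) (v : E), β = α → β.2 v = α.2 v := by
    rintro β v rfl
    rfl
  exact key _ _ (cotangentLift_one α)

/-- The canonical momentum map is a momentum map for the cotangent lifted action. -/
theorem canonicalTwoForm_generator (α : Cotangent E Q) (η : GroupLieAlgebra 𝓘(ℝ, EG) G)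
    {u : TangentSpace (cotangentModel E) α} (v : TangentSpace (cotangentModel E) α)
    (hu : (mfderiv 𝓘(ℝ, EG) (cotangentModel E) (fun g : G ↦ System.cotangentLift g α) 1 η :
      E × (E →L[ℝ] ℝ)) = u) :
    canonicalTwoForm α ![u, v] = mfderiv (cotangentModel E) 𝓘(ℝ, ℝ)
      (fun α : Cotangent E Q ↦ cotangentMomentum EG G α η) α v := by
  have hd : MDifferentiableAt (cotangentModel E) 𝓘(ℝ, ℝ)
      (fun α : Cotangent E Q ↦ cotangentMomentum EG G α η) α :=
    ((contMDiff_cotangentMomentum EG G).clm_apply contMDiff_const).mdifferentiableAt (by simp)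
  -- Cartan's formula for the invariant form `Θ_Q`; its minus sign is absorbed by `Ω_Q = -dΘ_Q`.
  have h := extDerivOneForm_generator (mdifferentiableAt_canonicalOneForm α)
    (contMDiff_cotangentLift E Q EG G) cotangentLift_one
    (fun g ↦ canonicalOneForm_cotangentLift EG g α v)
    (fun α ↦ (canonicalOneForm_generator α η).symm) hd hu
  rw [canonicalTwoForm]
  change -(extDerivOneForm (cotangentModel E) canonicalOneForm α ![u, v]) = _
  rw [h]
  exact neg_neg (_ : ℝ)

end Cotangent

theorem mfderiv_apply_congr {E H N E' H' N' : Type*} [NormedAddCommGroup E] [NormedSpace ℝ E]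
    [TopologicalSpace H] {I : ModelWithCorners ℝ E H} [TopologicalSpace N]
    [ChartedSpace H N] [NormedAddCommGroup E'] [NormedSpace ℝ E']
    [TopologicalSpace H'] {I' : ModelWithCorners ℝ E' H'} [TopologicalSpace N']
    [ChartedSpace H' N'] (f : N → N') {x y : N} {a : TangentSpace I x}
    {b : TangentSpace I y} (hxy : x = y) (hab : (a : E) = b) :
    (mfderiv I I' f x a : E') = mfderiv I I' f y b := by
  subst hxy
  exact congrArg (mfderiv I I' f x) hab

/-- A space and its dual have equal finite dimension, so an injective `A` is an equivalence and
`inverse` does not take its default value. -/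
theorem inverse_apply_of_injective {E : Type*} [NormedAddCommGroup E] [NormedSpace ℝ E]
    [FiniteDimensional ℝ E] {A : E →L[ℝ] E →L[ℝ] ℝ} (hA : Function.Injective A) (v : E) :
    A.inverse (A v) = v := by
  have hf : Module.finrank ℝ E = Module.finrank ℝ (E →L[ℝ] ℝ) := by
    rw [← (LinearMap.toContinuousLinearMap (𝕜 := ℝ) (E := E) (F' := ℝ)).finrank_eq]
    exact Subspace.dual_finrank_eq.symm
  let e := (LinearEquiv.ofInjectiveOfFinrankEq A.toLinearMap hA hf).toContinuousLinearEquiv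
  have he : (e : E →L[ℝ] E →L[ℝ] ℝ) = A := by ext; rfl
  rw [← he, ContinuousLinearMap.inverse_equiv]
  exact e.symm_apply_apply v

/-! ### Invariance of the metric and of the Hamiltonian. -/

section Metric

variable {E : Type*} [NormedAddCommGroup E] [NormedSpace ℝ E]
  {Q : Type*} [TopologicalSpace Q] [ChartedSpace E Q] [IsManifold 𝓘(ℝ, E) ∞ Q]
  {S : System E Q}

theorem inner_inverse_apply [FiniteDimensional ℝ E] (S : System E Q) (q : Q)
    (v : TangentSpace 𝓘(ℝ, E) q) :
    (S.κ.inner q).inverse (S.κ.inner q v) = v := by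
  refine inverse_apply_of_injective (E := E) (A := S.κ.inner q) ?_ v
  refine (injective_iff_map_eq_zero (S.κ.inner q)).2 fun x hx ↦ ?_
  by_contra h
  have h1 := S.κ.pos q x h
  rw [hx] at h1
  exact lt_irrefl _ h1

/-- Evaluation at the zero vector compares the potentials, so the quadratic part is preserved
separately; polarization then gives the bilinear form. -/
theorem inner_of_equiv {g : Q → Q} {q : Q}
    {A : TangentSpace 𝓘(ℝ, E) q ≃L[ℝ] TangentSpace 𝓘(ℝ, E) (g q)}
    (hL : ∀ x : TangentSpace 𝓘(ℝ, E) q, S.lagrangian ⟨g q, A x⟩ = S.lagrangian ⟨q, x⟩)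
    (x y : TangentSpace 𝓘(ℝ, E) q) :
    S.κ.inner (g q) (A x) (A y) = S.κ.inner q x y := by
  have hsq : ∀ x : TangentSpace 𝓘(ℝ, E) q,
      S.κ.inner (g q) (A x) (A x) = S.κ.inner q x x := by
    intro x
    have h0 := hL 0
    have h1 := hL x
    simp only [lagrangian, map_zero] at h0 h1
    linarith
  have h := hsq (x + y)
  simp only [map_add, add_apply] at h
  have h1 := hsq x
  have h2 := hsq y
  have h3 := S.κ.symm (g q) (A x) (A y)
  have h4 := S.κ.symm q x y
  linarith

/-- If `α = κ^♭(v)`, its lift is `κ^♭` of the image of `v`. The Legendre transform thus reduces to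
the invariance of `κ` and `L`. -/
theorem hamiltonian_cotangentLift [FiniteDimensional ℝ E] (EG : Type*) [NormedAddCommGroup EG]
    [NormedSpace ℝ EG]
    {G : Type*} [TopologicalSpace G] [ChartedSpace EG G] [Group G] [MulAction G Q]
    [ContMDiffSMul 𝓘(ℝ, EG) 𝓘(ℝ, E) ∞ G Q] (hS : S.IsSymmetry G) (g : G) {α : Cotangent E Q}
    (hα : α ∈ S.constraintSet) : S.hamiltonian (cotangentLift g α) = S.hamiltonian α := by
  obtain ⟨v, -, hv⟩ := hα
  obtain ⟨A, hA⟩ : ∃ A : TangentSpace 𝓘(ℝ, E) α.proj ≃L[ℝ] TangentSpace 𝓘(ℝ, E) (g • α.proj),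
      mfderiv 𝓘(ℝ, E) 𝓘(ℝ, E) (fun p : Q ↦ g • p) α.proj = A :=
    ⟨(Diffeomorph.smul 𝓘(ℝ, EG) 𝓘(ℝ, E) ∞ g).mfderivToContinuousLinearEquiv (by simp) α.proj, rfl⟩
  have hL : ∀ x, S.lagrangian ⟨g • α.proj, A x⟩ = S.lagrangian ⟨α.proj, x⟩ := fun x ↦ by
    have h := hS.lagrangian_inv g ⟨α.proj, x⟩
    simp only [tangentMap, hA] at h
    exact h
  have h2 : (cotangentLift g α).2 = S.κ.inner (g • α.proj) (A v) := by
    change α.2.comp (mfderiv 𝓘(ℝ, E) 𝓘(ℝ, E) (fun p : Q ↦ g • p) α.proj).inverse = _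
    rw [hA, ContinuousLinearMap.inverse_equiv, ← hv]
    ext y
    obtain ⟨x, rfl⟩ := A.surjective y
    rw [inner_of_equiv (g := fun p ↦ g • p) hL]
    simp
  have h3 : (S.κ.inner (cotangentLift g α).proj).inverse (cotangentLift g α).2 = A v := by
    rw [h2]
    exact inner_inverse_apply S _ _
  have h4 : (S.κ.inner α.proj).inverse α.2 = v := by
    rw [← hv]
    exact inner_inverse_apply S _ _
  unfold hamiltonian
  rw [h3, h4]
  refine congrArg₂ (· - ·) ?_ (hL v)
  rw [h2, ← hv]
  exact inner_of_equiv (g := fun p ↦ g • p) hL v v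

end Metric

/-! ### The action on `𝓜` and the nonholonomic Noether identity. -/

section Constraint

variable {E : Type*} [NormedAddCommGroup E] [NormedSpace ℝ E]
  {Q : Type*} [TopologicalSpace Q] [ChartedSpace E Q] [IsManifold 𝓘(ℝ, E) ∞ Q]
  {EG : Type*} [NormedAddCommGroup EG] [NormedSpace ℝ EG]
  {G : Type*} [TopologicalSpace G] [ChartedSpace EG G] [Group G] [LieGroup 𝓘(ℝ, EG) ∞ G]
  [MulAction G Q] [ContMDiffSMul 𝓘(ℝ, EG) 𝓘(ℝ, E) ∞ G Q]
  {S : System E Q}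
  {EM : Type*} [NormedAddCommGroup EM] [NormedSpace ℝ EM] [ChartedSpace EM S.Constraint]

theorem contMDiff_constraint_proj
    (hincl : IsSmoothEmbedding 𝓘(ℝ, EM) (cotangentModel E) ∞ S.incl) :
    ContMDiff 𝓘(ℝ, EM) 𝓘(ℝ, E) ∞ S.proj :=
  contMDiff_cotangent_proj.comp hincl.contMDiff

/-- Smoothness into an embedded submanifold can be tested after inclusion: the embedding supplies
continuity and the immersion the rest. -/
theorem contMDiff_act (hincl : IsSmoothEmbedding 𝓘(ℝ, EM) (cotangentModel E) ∞ S.incl)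
    (hS : S.IsSymmetry G) :
    ContMDiff (𝓘(ℝ, EG).prod 𝓘(ℝ, EM)) 𝓘(ℝ, EM) ∞ (Function.uncurry (act EG hS)) := by
  have h : ContMDiff (𝓘(ℝ, EG).prod 𝓘(ℝ, EM)) (cotangentModel E) ∞
      (S.incl ∘ Function.uncurry (act EG hS)) :=
    (contMDiff_cotangentLift E Q EG G).comp
      (contMDiff_fst.prodMk (hincl.contMDiff.comp contMDiff_snd))
  exact (ContMDiff.iff_comp_isImmersion hincl.isImmersion).2
    ⟨hincl.isEmbedding.continuous_iff.2 h.continuous, h⟩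

theorem act_one (hS : S.IsSymmetry G) (m : S.Constraint) : act EG hS 1 m = m :=
  Subtype.ext (cotangentLift_one m.1)

/-- The chain rule along the orbit map. It is used with `f` equal to `τ`, `ι` and `H_𝓜`. -/
theorem mfderiv_generatorM {E' H' N' : Type*} [NormedAddCommGroup E'] [NormedSpace ℝ E']
    [TopologicalSpace H'] {I' : ModelWithCorners ℝ E' H'} [TopologicalSpace N']
    [ChartedSpace H' N'] (hincl : IsSmoothEmbedding 𝓘(ℝ, EM) (cotangentModel E) ∞ S.incl)
    (hS : S.IsSymmetry G) {f : S.Constraint → N'} {m : S.Constraint}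
    (hf : MDifferentiableAt 𝓘(ℝ, EM) I' f m) (η : GroupLieAlgebra 𝓘(ℝ, EG) G) :
    (mfderiv 𝓘(ℝ, EM) I' f m (generatorM hS m η) : E') =
      mfderiv 𝓘(ℝ, EG) I' (fun g : G ↦ f (act EG hS g m)) 1 η := by
  have ho : MDifferentiableAt 𝓘(ℝ, EG) 𝓘(ℝ, EM) (fun g : G ↦ act EG hS g m) 1 :=
    ((contMDiff_act hincl hS).comp
      (contMDiff_id.prodMk contMDiff_const)).mdifferentiableAt (by simp)
  have h1 := act_one (EG := EG) hS m
  have hf' : MDifferentiableAt 𝓘(ℝ, EM) I' f (act EG hS (1 : G) m) := by rwa [h1]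
  have h2 := mfderiv_comp (1 : G) hf' ho
  refine Eq.trans ?_ (congrArg (fun B : EG →L[ℝ] E' ↦ B η) h2).symm
  exact mfderiv_apply_congr f h1.symm rfl

theorem mfderiv_proj_generatorM
    (hincl : IsSmoothEmbedding 𝓘(ℝ, EM) (cotangentModel E) ∞ S.incl)
    (hS : S.IsSymmetry G) (m : S.Constraint) (η : GroupLieAlgebra 𝓘(ℝ, EG) G) :
    mfderiv 𝓘(ℝ, EM) 𝓘(ℝ, E) S.proj m (generatorM hS m η) = generator E EG G (S.proj m) η :=
  mfderiv_generatorM hincl hS ((contMDiff_constraint_proj hincl).mdifferentiableAt (by simp)) η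

theorem generatorM_mem (hincl : IsSmoothEmbedding 𝓘(ℝ, EM) (cotangentModel E) ∞ S.incl)
    (hS : S.IsSymmetry G) {m : S.Constraint} {η : GroupLieAlgebra 𝓘(ℝ, EG) G}
    (hη : generator E EG G (S.proj m) η ∈ S.D (S.proj m)) :
    generatorM hS m η ∈ S.constraintDistribution (EM := EM) m := by
  change mfderiv 𝓘(ℝ, EM) 𝓘(ℝ, E) S.proj m (generatorM hS m η) ∈ S.D (S.proj m)
  rwa [mfderiv_proj_generatorM hincl]

/-- The inclusion intertwines the actions, so it carries `η_𝓜` to the generator on `T*Q`, and the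
momentum map identity there pulls back. -/
theorem twoFormM_generatorM (hincl : IsSmoothEmbedding 𝓘(ℝ, EM) (cotangentModel E) ∞ S.incl)
    (hS : S.IsSymmetry G) (m : S.Constraint) (η : GroupLieAlgebra 𝓘(ℝ, EG) G)
    (X : TangentSpace 𝓘(ℝ, EM) m) :
    S.twoFormM m ![generatorM hS m η, X] =
      S.deriv (fun m' ↦ momentumMap (EG := EG) (G := G) m' η) m X := by
  have hi : MDifferentiableAt 𝓘(ℝ, EM) (cotangentModel E) S.incl m :=
    hincl.contMDiff.mdifferentiableAt (by simp)
  have hd : MDifferentiableAt (cotangentModel E) 𝓘(ℝ, ℝ)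
      (fun α : Cotangent E Q ↦ cotangentMomentum EG G α η) (S.incl m) :=
    ((contMDiff_cotangentMomentum EG G).clm_apply contMDiff_const).mdifferentiableAt (by simp)
  have h1 := canonicalTwoForm_generator (S.incl m) η
    (mfderiv 𝓘(ℝ, EM) (cotangentModel E) S.incl m X) (mfderiv_generatorM hincl hS hi η).symm
  have h2 := mfderiv_comp m hd hi
  have h3 : S.twoFormM m ![generatorM hS m η, X] = canonicalTwoForm (S.incl m)
      ![mfderiv 𝓘(ℝ, EM) (cotangentModel E) S.incl m (generatorM hS m η),
        mfderiv 𝓘(ℝ, EM) (cotangentModel E) S.incl m X] := by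
    rw [twoFormM, ContinuousAlternatingMap.compContinuousLinearMap_apply]
    congr 1
    ext i
    fin_cases i <;> rfl
  rw [h3]
  exact h1.trans (congrArg (fun B : EM →L[ℝ] ℝ ↦ B X) h2).symm

theorem deriv_hamiltonianM_generatorM [FiniteDimensional ℝ E]
    (hincl : IsSmoothEmbedding 𝓘(ℝ, EM) (cotangentModel E) ∞ S.incl)
    (hS : S.IsSymmetry G) (m : S.Constraint) (η : GroupLieAlgebra 𝓘(ℝ, EG) G) :
    S.deriv S.hamiltonianM m (generatorM (EM := EM) hS m η) = 0 := by
  by_cases h : MDifferentiableAt 𝓘(ℝ, EM) 𝓘(ℝ, ℝ) S.hamiltonianM m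
  · have h1 := mfderiv_generatorM hincl hS h η
    have h2 : (fun g : G ↦ S.hamiltonianM (act EG hS g m)) = fun _ ↦ S.hamiltonianM m :=
      funext fun g ↦ hamiltonian_cotangentLift EG hS g m.2
    refine Eq.trans h1 ?_
    rw [h2, mfderiv_const]
    rfl
  -- Where `H_𝓜` is not differentiable, `mfderiv` is zero by convention, so no smoothness of the
  -- Hamiltonian has to be established.
  · rw [System.deriv, mfderiv_zero_of_not_mdifferentiableAt h]
    rfl

theorem nonholonomicField_mem (S : System E Q) [ChartedSpace EM S.Constraint] (m : S.Constraint) :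
    S.nonholonomicField (EM := EM) m ∈ S.constraintDistribution (EM := EM) m := by
  rw [nonholonomicField]
  split_ifs with h
  · exact h.choose_spec.1
  · exact Submodule.zero_mem _

/-- **Nonholonomic Noether identity**, pointwise: the momentum of an infinitesimal generator which
is tangent to the constraints at `m` has zero derivative along the nonholonomic field at `m`. -/
theorem deriv_momentumMap_nonholonomicField [FiniteDimensional ℝ E]
    (hincl : IsSmoothEmbedding 𝓘(ℝ, EM) (cotangentModel E) ∞ S.incl)
    (hS : S.IsSymmetry G) {m : S.Constraint} {η : GroupLieAlgebra 𝓘(ℝ, EG) G}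
    (hη : generator E EG G (S.proj m) η ∈ S.D (S.proj m)) :
    S.deriv (fun m' ↦ momentumMap (EG := EG) (G := G) m' η) m
      (S.nonholonomicField (EM := EM) m) = 0 := by
  by_cases h : ∃ X : TangentSpace 𝓘(ℝ, EM) m, S.IsNonholonomicVector m X
  · have hX : S.nonholonomicField m = h.choose := dif_pos h
    -- The derivative becomes `Ω_𝓜(η_𝓜, X)`. Swapping the arguments gives `-dH_𝓜(η_𝓜)`, by the
    -- defining equation tested on `η_𝓜 ∈ 𝓒`.
    rw [← twoFormM_generatorM hincl hS, hX]
    have h1 := h.choose_spec.2 _ (generatorM_mem hincl hS hη)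
    rw [deriv_hamiltonianM_generatorM hincl] at h1
    have h2 : S.twoFormM m (![h.choose, generatorM hS m η] ∘ Equiv.swap 0 1) =
        -S.twoFormM m ![h.choose, generatorM hS m η] :=
      (S.twoFormM m).map_swap _ (by simp)
    rw [h1, neg_zero] at h2
    rw [← h2]
    congr 1
    ext i
    fin_cases i <;> rfl
  -- The default value of the field is zero, so the identity needs no nondegeneracy of `Ω_𝓜` on `𝓒`.
  · have hX : S.nonholonomicField (EM := EM) m = 0 := dif_neg h
    rw [hX]
    exact map_zero (mfderiv 𝓘(ℝ, EM) 𝓘(ℝ, ℝ) _ m)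

end Constraint

/-! ### The connection on `Q` with kernel `D` and values in `𝔴`. -/

section BaseConnection

variable {E : Type*} [NormedAddCommGroup E] [NormedSpace ℝ E]
  {Q : Type*} [TopologicalSpace Q] [ChartedSpace E Q] [IsManifold 𝓘(ℝ, E) ∞ Q]
  {EG : Type*} [NormedAddCommGroup EG] [NormedSpace ℝ EG]
  {G : Type*} [TopologicalSpace G] [ChartedSpace EG G] [Group G]
  [MulAction G Q]
  {S : System E Q} {W : ∀ q : Q, Submodule ℝ (TangentSpace 𝓘(ℝ, E) q)}
  {w : Submodule ℝ (GroupLieAlgebra 𝓘(ℝ, EG) G)}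

/-- The difference of the two candidates lies in both `𝔤_S` and `𝔴`. This uniqueness gives the
linearity of the connection and every later evaluation of it. -/
theorem eq_of_sub_generator_mem (hW : S.IsVerticalComplement EG G W) (hw : VerticalSymmetry W w)
    {q : Q} {v : TangentSpace 𝓘(ℝ, E) q} {ζ ζ' : GroupLieAlgebra 𝓘(ℝ, EG) G}
    (hζ : ζ ∈ w) (hζ' : ζ' ∈ w) (h : v - generator E EG G q ζ ∈ S.D q)
    (h' : v - generator E EG G q ζ' ∈ S.D q) : ζ = ζ' := by
  have h1 : generator E EG G q (ζ' - ζ) ∈ S.D q := by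
    have h2 := (S.D q).sub_mem h h'
    rwa [sub_sub_sub_cancel_left, ← map_sub] at h2
  have h3 : ζ' - ζ ∈ S.gS EG G q := ⟨h1, ⟨ζ' - ζ, rfl⟩⟩
  exact (sub_eq_zero.1 (Submodule.disjoint_def.1 (isCompl_gS hW hw q).disjoint _ h3
    (w.sub_mem hζ' hζ))).symm

theorem exists_sub_generator_mem (hW : S.IsVerticalComplement EG G W) (hw : VerticalSymmetry W w)
    (q : Q) (v : TangentSpace 𝓘(ℝ, E) q) :
    ∃ ζ ∈ w, v - generator E EG G q ζ ∈ S.D q := by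
  have h0 : v ∈ S.D q ⊔ W q := by
    rw [(hW.isCompl q).sup_eq_top]
    exact Submodule.mem_top
  obtain ⟨d, hd, x, hx, rfl⟩ := Submodule.mem_sup.1 h0
  rw [← hw.map_eq q] at hx
  obtain ⟨ζ, hζ, rfl⟩ := hx
  exact ⟨ζ, hζ, by simpa using hd⟩

theorem exists_baseConnection [FiniteDimensional ℝ E] (hW : S.IsVerticalComplement EG G W)
    (hw : VerticalSymmetry W w) (q : Q) :
    ∃ A : TangentSpace 𝓘(ℝ, E) q →L[ℝ] GroupLieAlgebra 𝓘(ℝ, EG) G, ∀ v, A v ∈ w ∧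
      v - generator E EG G q (A v) ∈ S.D q := by
  choose A hA hAD using exists_sub_generator_mem hW hw q
  let L : TangentSpace 𝓘(ℝ, E) q →ₗ[ℝ] GroupLieAlgebra 𝓘(ℝ, EG) G :=
    { toFun := A
      map_add' := fun x y ↦ by
        refine eq_of_sub_generator_mem hW hw (hA (x + y)) (w.add_mem (hA x) (hA y)) (hAD (x + y)) ?_
        have h := (S.D q).add_mem (hAD x) (hAD y)
        rw [sub_add_sub_comm, ← map_add] at h
        exact h
      map_smul' := fun c x ↦ by
        refine eq_of_sub_generator_mem hW hw (hA (c • x)) (w.smul_mem c (hA x)) (hAD (c • x)) ?_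
        have h := (S.D q).smul_mem c (hAD x)
        rw [smul_sub, ← map_smul] at h
        exact h }
  exact ⟨LinearMap.toContinuousLinearMap (𝕜 := ℝ) (E := E) (F' := EG) L, fun v ↦ ⟨hA v, hAD v⟩⟩

/-- The `𝔤`-valued 1-form on `Q` whose value on `v` is the `ζ ∈ 𝔴` such that `ζ_Q` is the component
of `v` in `W` along the constraint distribution. -/
def baseConnection [FiniteDimensional ℝ E] (hW : S.IsVerticalComplement EG G W)
    (hw : VerticalSymmetry W w) (q : Q) :
    TangentSpace 𝓘(ℝ, E) q →L[ℝ] GroupLieAlgebra 𝓘(ℝ, EG) G :=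
  (exists_baseConnection hW hw q).choose

variable [FiniteDimensional ℝ E] (hW : S.IsVerticalComplement EG G W) (hw : VerticalSymmetry W w)

theorem baseConnection_mem (q : Q) (v : TangentSpace 𝓘(ℝ, E) q) :
    baseConnection hW hw q v ∈ w :=
  ((exists_baseConnection hW hw q).choose_spec v).1

theorem sub_generator_baseConnection_mem (q : Q) (v : TangentSpace 𝓘(ℝ, E) q) :
    v - generator E EG G q (baseConnection hW hw q v) ∈ S.D q :=
  ((exists_baseConnection hW hw q).choose_spec v).2

theorem baseConnection_eq {q : Q} {v : TangentSpace 𝓘(ℝ, E) q}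
    {ζ : GroupLieAlgebra 𝓘(ℝ, EG) G} (hζ : ζ ∈ w) (h : v - generator E EG G q ζ ∈ S.D q) :
    baseConnection hW hw q v = ζ :=
  eq_of_sub_generator_mem hW hw (baseConnection_mem hW hw q v) hζ
    (sub_generator_baseConnection_mem hW hw q v) h

/-- Expresses a projection defined fibre by fibre through the connection, whose smoothness can be
checked in a frame. -/
theorem projGS_eq (η : GroupLieAlgebra 𝓘(ℝ, EG) G) (q : Q) :
    projGS hW hw η q = η - baseConnection hW hw q (generator E EG G q η) := by
  set ζ := baseConnection hW hw q (generator E EG G q η) with hζ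
  have h1 : ζ ∈ w := baseConnection_mem hW hw q _
  have h2 : η - ζ ∈ S.gS EG G q := by
    refine ⟨?_, ⟨η - ζ, rfl⟩⟩
    change generator E EG G q (η - ζ) ∈ S.D q
    rw [map_sub]
    exact sub_generator_baseConnection_mem hW hw q _
  have h3 : projGS hW hw (η - ζ + ζ) q = η - ζ := by
    rw [projGS, map_add, Submodule.projection_apply_of_mem_left _ h2,
      Submodule.projection_apply_of_mem_right _ h1, add_zero]
  rwa [sub_add_cancel] at h3

end BaseConnection

/-! ### Local frames adapted to `TQ = D ⊕ W`. -/

section Frame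

variable {E : Type*} [NormedAddCommGroup E] [NormedSpace ℝ E]
  {Q : Type*} [TopologicalSpace Q] [ChartedSpace E Q] {EG : Type*} [NormedAddCommGroup EG]
  [NormedSpace ℝ EG]

theorem contMDiffAt_trivialization_vectorField [IsManifold 𝓘(ℝ, E) ∞ Q] {q₀ : Q}
    {X : ∀ q : Q, TangentSpace 𝓘(ℝ, E) q}
    (hX : ContMDiffAt 𝓘(ℝ, E) 𝓘(ℝ, E).tangent ∞
      (fun q ↦ (⟨q, X q⟩ : TangentBundle 𝓘(ℝ, E) Q)) q₀) :
    ContMDiffAt 𝓘(ℝ, E) 𝓘(ℝ, E) ∞ (fun q ↦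
      (trivializationAt E (TangentSpace 𝓘(ℝ, E)) q₀).continuousLinearMapAt ℝ q (X q)) q₀ := by
  refine (contMDiffAt_totalSpace.1 hX).2.congr_of_eventuallyEq ?_
  filter_upwards [chart_source_mem_nhds E q₀] with q hq
  rw [Trivialization.continuousLinearMapAt_apply, Trivialization.coe_linearMapAt_of_mem _ hq]

/-- A frame of `E`, made of the vectors `x i` and of the image of a subspace `w` under `g`, as a
linear map. -/
def frameMap {r : ℕ} (w : Submodule ℝ EG) (x : Fin r → E) (g : EG →L[ℝ] E) :
    ((Fin r → ℝ) × w) →L[ℝ] E :=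
  ∑ i, ((ContinuousLinearMap.proj i).comp (ContinuousLinearMap.fst ℝ (Fin r → ℝ) w)).smulRight
    (x i) + g.comp (w.subtypeL.comp (ContinuousLinearMap.snd ℝ (Fin r → ℝ) w))

theorem frameMap_apply {r : ℕ} (w : Submodule ℝ EG) (x : Fin r → E) (g : EG →L[ℝ] E)
    (p : (Fin r → ℝ) × w) : frameMap w x g p = ∑ i, p.1 i • x i + g p.2 := by
  simp [frameMap]

theorem contDiff_frameMap {r : ℕ} (w : Submodule ℝ EG) :
    ContDiff ℝ ∞ (fun p : (Fin r → E) × (EG →L[ℝ] E) ↦ frameMap w p.1 p.2) := by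
  refine ContDiff.add (ContDiff.sum fun i _ ↦ ?_) (contDiff_snd.clm_comp contDiff_const)
  exact ((ContinuousLinearMap.smulRightL ℝ ((Fin r → ℝ) × w) E
    ((ContinuousLinearMap.proj i).comp (ContinuousLinearMap.fst ℝ (Fin r → ℝ) w))).contDiff).comp
      ((contDiff_apply ℝ E i).comp contDiff_fst)

theorem contMDiffAt_frameMap {r : ℕ} (w : Submodule ℝ EG) {x : Q → Fin r → E}
    {g : Q → EG →L[ℝ] E} {q₀ : Q} (hx : ∀ i, ContMDiffAt 𝓘(ℝ, E) 𝓘(ℝ, E) ∞ (fun q ↦ x q i) q₀)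
    (hg : ContMDiffAt 𝓘(ℝ, E) 𝓘(ℝ, EG →L[ℝ] E) ∞ g q₀) :
    ContMDiffAt 𝓘(ℝ, E) 𝓘(ℝ, ((Fin r → ℝ) × w) →L[ℝ] E) ∞ (fun q ↦ frameMap w (x q) (g q)) q₀ := by
  have hx' : ContMDiffAt 𝓘(ℝ, E) 𝓘(ℝ, Fin r → E) ∞ x q₀ := contMDiffAt_pi_space.2 hx
  have hxg : ContMDiffAt 𝓘(ℝ, E) 𝓘(ℝ, (Fin r → E) × (EG →L[ℝ] E)) ∞
      (fun q ↦ (x q, g q)) q₀ := hx'.prodMk_space hg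
  exact ContMDiffAt.comp q₀ (g := fun p : (Fin r → E) × (EG →L[ℝ] E) ↦ frameMap w p.1 p.2)
    (contDiff_frameMap w).contDiffAt.contMDiffAt hxg

end Frame

/-! ### Smoothness of the connection and of `P_{𝔤_S}`. -/

section Smooth

variable {E : Type*} [NormedAddCommGroup E] [NormedSpace ℝ E] [FiniteDimensional ℝ E]
  {Q : Type*} [TopologicalSpace Q] [ChartedSpace E Q] [IsManifold 𝓘(ℝ, E) ∞ Q]
  {EG : Type*} [NormedAddCommGroup EG] [NormedSpace ℝ EG] [FiniteDimensional ℝ EG]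
  {G : Type*} [TopologicalSpace G] [ChartedSpace EG G] [Group G] [LieGroup 𝓘(ℝ, EG) ∞ G]
  [MulAction G Q] [ContMDiffSMul 𝓘(ℝ, EG) 𝓘(ℝ, E) ∞ G Q]
  {S : System E Q} {W : ∀ q : Q, Submodule ℝ (TangentSpace 𝓘(ℝ, E) q)}
  {w : Submodule ℝ (GroupLieAlgebra 𝓘(ℝ, EG) G)}
  (hW : S.IsVerticalComplement EG G W) (hw : VerticalSymmetry W w)

/-- The form `baseConnection`, read in the trivialization of `TQ` at `q₀`. -/
def baseConnectionInTriv (q₀ q : Q) : E →L[ℝ] EG :=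
  (baseConnection hW hw q).comp ((trivializationAt E (TangentSpace 𝓘(ℝ, E)) q₀).symmL ℝ q)

/-- The projection of `𝔤` onto `𝔴` along the fibre of `𝔤_S` at `q`. -/
def projW (q : Q) : EG →L[ℝ] EG :=
  (baseConnection hW hw q).comp (generator E EG G q)

/-- A local frame of `D` together with `Ψ` on `𝔴` gives isomorphisms `B q` from `ℝ^r × 𝔴` to `E`,
smooth in `q`. The connection is the second component of the inverse of `B q`, and operator
inversion is smooth at invertible operators. -/
theorem contMDiffAt_baseConnectionInTriv (q₀ : Q) :
    ContMDiffAt 𝓘(ℝ, E) 𝓘(ℝ, E →L[ℝ] EG) ∞ (baseConnectionInTriv hW hw q₀) q₀ := by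
  obtain ⟨u, hu, X, hX, hXD⟩ := S.isSmoothDistribution_D q₀
  let w' : Submodule ℝ EG := w
  let t := trivializationAt E (TangentSpace 𝓘(ℝ, E)) q₀
  let x : Q → Fin S.rank → E := fun q i ↦ t.continuousLinearMapAt ℝ q (X i q)
  let B : Q → (((Fin S.rank → ℝ) × w') →L[ℝ] E) := fun q ↦
    frameMap w' (x q) (generatorInTriv EG G q₀ q)
  have hB : ContMDiffAt 𝓘(ℝ, E) 𝓘(ℝ, ((Fin S.rank → ℝ) × w') →L[ℝ] E) ∞ B q₀ := by
    exact contMDiffAt_frameMap w' (fun i ↦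
      contMDiffAt_trivialization_vectorField ((hX i).contMDiffAt hu))
      (contMDiffAt_generatorInTriv EG G q₀)
  have hmain : ∀ᶠ q in 𝓝 q₀, ∃ e : ((Fin S.rank → ℝ) × w') ≃L[ℝ] E, B q = e ∧
      baseConnectionInTriv hW hw q₀ q =
        (w'.subtypeL.comp (ContinuousLinearMap.snd ℝ (Fin S.rank → ℝ) w')).comp
          (e.symm : E →L[ℝ] (Fin S.rank → ℝ) × w') := by
    filter_upwards [hu, chart_source_mem_nhds E q₀] with q hqu hq
    obtain ⟨hli, hspan⟩ := hXD q hqu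
    have hBq : ∀ p, B q p = t.continuousLinearMapAt ℝ q
        (∑ i, p.1 i • X i q + generator E EG G q (p.2 : EG)) := by
      intro p
      rw [map_add, map_sum]
      simp only [map_smul]
      exact frameMap_apply w' _ _ p
    have hts : ∀ v : TangentSpace 𝓘(ℝ, E) q, t.symmL ℝ q (t.continuousLinearMapAt ℝ q v) = v :=
      fun v ↦ t.symmL_continuousLinearMapAt (R := ℝ) hq v
    have hst : ∀ v : E, t.continuousLinearMapAt ℝ q (t.symmL ℝ q v) = v :=
      fun v ↦ t.continuousLinearMapAt_symmL (R := ℝ) hq v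
    have hmem : ∀ a : Fin S.rank → ℝ, ∑ i, a i • X i q ∈ S.D q := fun a ↦ by
      rw [← hspan]
      exact Submodule.sum_mem _ fun i _ ↦ Submodule.smul_mem _ _
        (Submodule.subset_span ⟨i, rfl⟩)
    -- The frame part lies in `D`, so the connection returns the `𝔴` part. Both the injectivity of
    -- `B q` and the formula through its inverse come from this.
    have hA : ∀ p : (Fin S.rank → ℝ) × w', baseConnection hW hw q (t.symmL ℝ q (B q p)) =
        (p.2 : EG) := by
      intro p
      rw [hBq, hts]
      refine baseConnection_eq hW hw p.2.2 ?_
      rw [add_sub_cancel_right]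
      exact hmem p.1
    have hinj : Function.Injective (B q) := by
      refine (injective_iff_map_eq_zero (B q)).2 fun p hp ↦ ?_
      have h2 := hA p
      rw [hp, map_zero, map_zero] at h2
      have h2' : p.2 = 0 := Subtype.ext h2.symm
      have h3 := hts (∑ i, p.1 i • X i q + generator E EG G q (p.2 : EG))
      rw [← hBq, hp, map_zero, h2'] at h3
      have h4 : ∑ i, p.1 i • X i q = 0 := by
        refine Eq.trans ?_ h3.symm
        refine Eq.trans ?_ (congrArg (_ + ·) (map_zero (generator E EG G q)).symm)
        exact (add_zero _).symm
      exact Prod.ext (funext (Fintype.linearIndependent_iff.1 hli p.1 h4)) h2'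
    have hsurj : Function.Surjective (B q) := by
      intro y
      have h1 := sub_generator_baseConnection_mem hW hw q (t.symmL ℝ q y)
      rw [← hspan] at h1
      obtain ⟨a, ha⟩ := (Submodule.mem_span_range_iff_exists_fun ℝ).1 h1
      refine ⟨(a, ⟨_, baseConnection_mem hW hw q (t.symmL ℝ q y)⟩), ?_⟩
      rw [hBq, ha, sub_add_cancel]
      exact hst y
    let e : ((Fin S.rank → ℝ) × w') ≃L[ℝ] E :=
      (LinearEquiv.ofBijective (B q).toLinearMap ⟨hinj, hsurj⟩).toContinuousLinearEquiv
    refine ⟨e, by ext <;> rfl, ?_⟩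
    ext y
    obtain ⟨p, rfl⟩ := hsurj y
    refine (hA p).trans ?_
    have h5 : e.symm (B q p) = p := e.symm_apply_apply p
    exact congrArg (fun z : (Fin S.rank → ℝ) × w' ↦ (z.2 : EG)) h5.symm
  obtain ⟨e₀, he₀, -⟩ := hmain.self_of_nhds
  have hinv : ContMDiffAt 𝓘(ℝ, E) 𝓘(ℝ, E →L[ℝ] ((Fin S.rank → ℝ) × w')) ∞
      (fun q ↦ (B q).inverse) q₀ := by
    have h1 : ContDiffAt ℝ ∞ ContinuousLinearMap.inverse (B q₀) := by
      rw [he₀]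
      exact contDiffAt_map_inverse e₀
    exact ContMDiffAt.comp q₀ h1.contMDiffAt hB
  refine ((contMDiffAt_const (c := w'.subtypeL.comp
    (ContinuousLinearMap.snd ℝ (Fin S.rank → ℝ) w'))).clm_comp hinv).congr_of_eventuallyEq ?_
  filter_upwards [hmain] with q ⟨e, he, h⟩
  rw [he, ContinuousLinearMap.inverse_equiv]
  exact h

/-- The projection onto `𝔴` along `𝔤_S` is smooth. -/
theorem contMDiff_projW :
    ContMDiff 𝓘(ℝ, E) 𝓘(ℝ, EG →L[ℝ] EG) ∞ (projW hW hw) := by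
  intro q₀
  refine ((contMDiffAt_baseConnectionInTriv hW hw q₀).clm_comp
    (contMDiffAt_generatorInTriv EG G q₀)).congr_of_eventuallyEq ?_
  filter_upwards [chart_source_mem_nhds E q₀] with q hq
  ext v
  exact congrArg (baseConnection hW hw q)
    ((trivializationAt E (TangentSpace 𝓘(ℝ, E)) q₀).symmL_continuousLinearMapAt
      (R := ℝ) hq _).symm

theorem contMDiff_projGS (η : GroupLieAlgebra 𝓘(ℝ, EG) G) :
    ContMDiff (M' := EG) 𝓘(ℝ, E) 𝓘(ℝ, EG) ∞ (projGS hW hw η) := by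
  have h : projGS hW hw η = fun q ↦ η - baseConnection hW hw q (generator E EG G q η) :=
      funext (projGS_eq hW hw η)
  rw [h]
  have h1 : ∀ η : EG, ContMDiff 𝓘(ℝ, E) 𝓘(ℝ, EG) ∞ (fun q ↦ η - projW hW hw q η) := fun η ↦
    contMDiff_const.sub ((contMDiff_projW hW hw).clm_apply contMDiff_const)
  exact h1 η

end Smooth

theorem hasDerivAt_comp_curve {E H N F : Type*} [NormedAddCommGroup E] [NormedSpace ℝ E]
    [TopologicalSpace H] {I : ModelWithCorners ℝ E H} [TopologicalSpace N]
    [ChartedSpace H N] [NormedAddCommGroup F] [NormedSpace ℝ F] {f : N → F} {γ : ℝ → N}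
    (hf : MDifferentiableAt I 𝓘(ℝ, F) f (γ 0)) (hγ : ContMDiffAt 𝓘(ℝ, ℝ) I ∞ γ 0)
    {v : TangentSpace I (γ 0)} (hv : (mfderiv 𝓘(ℝ, ℝ) I γ 0 (1 : ℝ) : E) = v) :
    HasDerivAt (fun t ↦ f (γ t)) (mfderiv I 𝓘(ℝ, F) f (γ 0) v : F) 0 := by
  have h : ∀ L : ℝ →L[ℝ] F, HasFDerivAt (f ∘ γ) L 0 → HasDerivAt (f ∘ γ) (L 1) 0 :=
    fun L hL ↦ hL.hasDerivAt
  have h4 := hf.hasMFDerivAt.comp 0 (hγ.mdifferentiableAt (by simp)).hasMFDerivAt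
  exact (h _ h4.hasFDerivAt).congr_deriv (congrArg (mfderiv I 𝓘(ℝ, F) f (γ 0)) hv)

/-! ### The form `𝒜_𝓦` and its curvature. -/

section Connection

variable {E : Type*} [NormedAddCommGroup E] [NormedSpace ℝ E] [FiniteDimensional ℝ E]
  {Q : Type*} [TopologicalSpace Q] [ChartedSpace E Q] [IsManifold 𝓘(ℝ, E) ∞ Q]
  {EG : Type*} [NormedAddCommGroup EG] [NormedSpace ℝ EG] [FiniteDimensional ℝ EG]
  {G : Type*} [TopologicalSpace G] [ChartedSpace EG G] [Group G] [LieGroup 𝓘(ℝ, EG) ∞ G]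
  [MulAction G Q] [ContMDiffSMul 𝓘(ℝ, EG) 𝓘(ℝ, E) ∞ G Q]
  {S : System E Q}
  {EM : Type*} [NormedAddCommGroup EM] [NormedSpace ℝ EM] [ChartedSpace EM S.Constraint]
  [IsManifold 𝓘(ℝ, EM) ∞ S.Constraint]
  {W : ∀ q : Q, Submodule ℝ (TangentSpace 𝓘(ℝ, E) q)}
  {w : Submodule ℝ (GroupLieAlgebra 𝓘(ℝ, EG) G)}

/-- The form `𝒜_𝓦` is the pull-back by `τ` of a form on `Q`. -/
theorem connectionForm_apply
    (hincl : IsSmoothEmbedding 𝓘(ℝ, EM) (cotangentModel E) ∞ S.incl) (hS : S.IsSymmetry G)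
    (hW : S.IsVerticalComplement EG G W) (hw : VerticalSymmetry W w) (m : S.Constraint)
    (v : TangentSpace 𝓘(ℝ, EM) m) :
    connectionForm hS w m v =
      baseConnection hW hw (S.proj m) (mfderiv 𝓘(ℝ, EM) 𝓘(ℝ, E) S.proj m v) := by
  -- `𝓒` is the preimage of `D` under `Tτ`, and `η_𝓜` projects to `η_Q`; hence the defining
  -- conditions on `𝓜` and on `Q` agree.
  have hiff : ∀ (v : TangentSpace 𝓘(ℝ, EM) m) (ζ : GroupLieAlgebra 𝓘(ℝ, EG) G),
      v - generatorM hS m ζ ∈ S.constraintDistribution (EM := EM) m ↔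
        mfderiv 𝓘(ℝ, EM) 𝓘(ℝ, E) S.proj m v - generator E EG G (S.proj m) ζ ∈
          S.D (S.proj m) := by
    intro v ζ
    rw [← mfderiv_proj_generatorM hincl hS, ← map_sub]
    rfl
  have h : ∃ A : TangentSpace 𝓘(ℝ, EM) m →L[ℝ] GroupLieAlgebra 𝓘(ℝ, EG) G,
      ∀ v, A v ∈ w ∧ v - generatorM hS m (A v) ∈ S.constraintDistribution (EM := EM) m :=
    ⟨(baseConnection hW hw (S.proj m)).comp (mfderiv 𝓘(ℝ, EM) 𝓘(ℝ, E) S.proj m), fun v ↦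
      ⟨baseConnection_mem hW hw _ _,
        (hiff v _).2 (sub_generator_baseConnection_mem hW hw _ _)⟩⟩
  have h1 : connectionForm hS w m = h.choose := dif_pos h
  rw [h1]
  exact (baseConnection_eq hW hw (h.choose_spec v).1
    ((hiff v _).1 (h.choose_spec v).2)).symm

theorem mdifferentiableAt_connectionForm
    (hincl : IsSmoothEmbedding 𝓘(ℝ, EM) (cotangentModel E) ∞ S.incl) (hS : S.IsSymmetry G)
    (hW : S.IsVerticalComplement EG G W) (hw : VerticalSymmetry W w) (m₀ : S.Constraint) :
    MDifferentiableAt 𝓘(ℝ, EM) 𝓘(ℝ, EM →L[ℝ] EG)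
      (fun m ↦ (connectionForm hS w m).comp
        ((trivializationAt EM (TangentSpace 𝓘(ℝ, EM)) m₀).symmL ℝ m)) m₀ := by
  have hπ := contMDiff_constraint_proj hincl
  have h0 := ContMDiffAt.mfderiv_const (m := ∞) (n := ∞) (hπ m₀) (by simp)
  have h1 := ((contMDiffAt_baseConnectionInTriv hW hw (S.proj m₀)).comp m₀ (hπ m₀)).clm_comp h0
  refine (h1.congr_of_eventuallyEq ?_).mdifferentiableAt (by simp)
  filter_upwards [hπ.continuous.continuousAt.preimage_mem_nhds
    (chart_source_mem_nhds E (S.proj m₀))] with m hm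
  refine ContinuousLinearMap.ext fun v ↦ ?_
  refine (connectionForm_apply hincl hS hW hw m _).trans ?_
  exact congrArg (baseConnection hW hw (S.proj m))
    ((trivializationAt E (TangentSpace 𝓘(ℝ, E)) (S.proj m₀)).symmL_continuousLinearMapAt
      (R := ℝ) hm _).symm

theorem connectionForm_eq_zero
    (hincl : IsSmoothEmbedding 𝓘(ℝ, EM) (cotangentModel E) ∞ S.incl) (hS : S.IsSymmetry G)
    (hW : S.IsVerticalComplement EG G W) (hw : VerticalSymmetry W w) {m : S.Constraint}
    {v : TangentSpace 𝓘(ℝ, EM) m}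
    (hv : v ∈ S.constraintDistribution (EM := EM) m) : connectionForm hS w m v = 0 := by
  refine (connectionForm_apply hincl hS hW hw m v).trans
    (baseConnection_eq hW hw (ζ := (0 : GroupLieAlgebra 𝓘(ℝ, EG) G)) w.zero_mem ?_)
  rw [map_zero, sub_zero]
  exact hv

theorem connectionForm_generatorM
    (hincl : IsSmoothEmbedding 𝓘(ℝ, EM) (cotangentModel E) ∞ S.incl) (hS : S.IsSymmetry G)
    (hW : S.IsVerticalComplement EG G W) (hw : VerticalSymmetry W w) (m : S.Constraint)
    (η : GroupLieAlgebra 𝓘(ℝ, EG) G) :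
    connectionForm (EM := EM) hS w m (generatorM hS m η) = projW hW hw (S.proj m) η := by
  rw [connectionForm_apply hincl hS hW hw, mfderiv_proj_generatorM hincl hS]
  rfl

theorem projC_eq_self
    (hincl : IsSmoothEmbedding 𝓘(ℝ, EM) (cotangentModel E) ∞ S.incl) (hS : S.IsSymmetry G)
    (hW : S.IsVerticalComplement EG G W) (hw : VerticalSymmetry W w) {m : S.Constraint}
    {v : TangentSpace 𝓘(ℝ, EM) m}
    (hv : v ∈ S.constraintDistribution (EM := EM) m) : projC hS w m v = v := by
  rw [projC, connectionForm_eq_zero hincl hS hW hw hv]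
  exact (congrArg (v - ·) (map_zero (generatorM (EG := EG) (G := G) hS m))).trans (sub_zero v)

/-- Follows from equivariance of `τ` and invariance of `D`. It supplies the invariance hypothesis of
Cartan's formula: `𝒜_𝓦` vanishes on all translates of a vector of `𝓒`. -/
theorem mfderiv_act_mem
    (hincl : IsSmoothEmbedding 𝓘(ℝ, EM) (cotangentModel E) ∞ S.incl) (hS : S.IsSymmetry G)
    {m : S.Constraint} {v : TangentSpace 𝓘(ℝ, EM) m}
    (hv : v ∈ S.constraintDistribution (EM := EM) m) (g : G) :
    mfderiv 𝓘(ℝ, EM) 𝓘(ℝ, EM) (act EG hS g) m v ∈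
      S.constraintDistribution (EM := EM) (act EG hS g m) := by
  have hπ : MDifferentiable 𝓘(ℝ, EM) 𝓘(ℝ, E) S.proj :=
    (contMDiff_constraint_proj hincl).mdifferentiable (by simp)
  have hg : MDifferentiable 𝓘(ℝ, EM) 𝓘(ℝ, EM) (act EG hS g) :=
    ((contMDiff_act (EG := EG) (G := G) hincl hS).comp
        (contMDiff_const.prodMk contMDiff_id)).mdifferentiable
      (by simp)
  have hs : MDifferentiable 𝓘(ℝ, E) 𝓘(ℝ, E) (fun p : Q ↦ g • p) :=
    (Diffeomorph.smul 𝓘(ℝ, EG) 𝓘(ℝ, E) ∞ g).contMDiff.mdifferentiable (by simp)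
  have h1 := mfderiv_comp m (hπ _) (hg m)
  have h2 := mfderiv_comp m (hs _) (hπ m)
  have h3 : S.proj ∘ act EG hS g = (fun p : Q ↦ g • p) ∘ S.proj := rfl
  rw [h3, h2] at h1
  have h4 := hS.distribution_inv g (S.proj m) _ hv
  have h5 := congrArg (fun B : EM →L[ℝ] E ↦ B v) h1
  change mfderiv 𝓘(ℝ, EM) 𝓘(ℝ, E) S.proj (act EG hS g m)
    (mfderiv 𝓘(ℝ, EM) 𝓘(ℝ, EM) (act EG hS g) m v) ∈ S.D (g • S.proj m)
  have h6 : (mfderiv 𝓘(ℝ, EM) 𝓘(ℝ, E) S.proj (act EG hS g m)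
    (mfderiv 𝓘(ℝ, EM) 𝓘(ℝ, EM) (act EG hS g) m v) : E) =
      mfderiv 𝓘(ℝ, E) 𝓘(ℝ, E) (fun p : Q ↦ g • p) (S.proj m)
        (mfderiv 𝓘(ℝ, EM) 𝓘(ℝ, E) S.proj m v) := h5.symm
  exact h6 ▸ h4

/-- The section `P_{𝔤_S}(η)`, pulled back to `𝓜`, as a function with values in the model space. -/
def pullbackProjGS (hW : S.IsVerticalComplement EG G W) (hw : VerticalSymmetry W w)
    (η : GroupLieAlgebra 𝓘(ℝ, EG) G) (m : S.Constraint) : EG :=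
  projGS hW hw η (S.proj m)

theorem contMDiff_pullbackProjGS
    (hincl : IsSmoothEmbedding 𝓘(ℝ, EM) (cotangentModel E) ∞ S.incl)
    (hW : S.IsVerticalComplement EG G W) (hw : VerticalSymmetry W w)
    (η : GroupLieAlgebra 𝓘(ℝ, EG) G) :
    ContMDiff 𝓘(ℝ, EM) 𝓘(ℝ, EG) ∞ (pullbackProjGS hW hw η) :=
  (contMDiff_projGS hW hw η).comp (contMDiff_constraint_proj hincl)

/-- The value at `q` is `η - ζ` with `ζ ∈ 𝔴`. The projection at `q'` fixes `ζ`, because `𝔴` is the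
same subspace at every point. -/
theorem projW_projGS (hW : S.IsVerticalComplement EG G W) (hw : VerticalSymmetry W w)
    (η : GroupLieAlgebra 𝓘(ℝ, EG) G) (q q' : Q) :
    projW hW hw q' (projGS hW hw η q) = projGS hW hw η q - projGS hW hw η q' := by
  set ζ := baseConnection hW hw q (generator E EG G q η) with hζ
  have h1 : baseConnection hW hw q' (generator E EG G q' ζ) = ζ :=
    baseConnection_eq hW hw (baseConnection_mem hW hw q _) (by
      rw [sub_self]
      exact (S.D q').zero_mem)
  change baseConnection hW hw q' (generator E EG G q' (projGS hW hw η q)) = _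
  rw [projGS_eq hW hw η q, projGS_eq hW hw η q', ← hζ, map_sub, map_sub, h1]
  abel

/-- The `𝓦`-curvature on the infinitesimal generator of a section of `𝔤_S` and a vector in `𝓒`. -/
theorem curvature_projGS
    (hincl : IsSmoothEmbedding 𝓘(ℝ, EM) (cotangentModel E) ∞ S.incl) (hS : S.IsSymmetry G)
    (hW : S.IsVerticalComplement EG G W) (hw : VerticalSymmetry W w)
    (η : GroupLieAlgebra 𝓘(ℝ, EG) G) (m : S.Constraint)
    {X : TangentSpace 𝓘(ℝ, EM) m} (hX : X ∈ S.constraintDistribution (EM := EM) m) :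
    curvature hS w m (sectionFieldM hS (projGS hW hw η) m) X =
      (mfderiv 𝓘(ℝ, EM) 𝓘(ℝ, EG) (pullbackProjGS hW hw η) m X : EG) := by
  set ξ := projGS hW hw η (S.proj m) with hξ
  have hY : generatorM hS m ξ ∈ S.constraintDistribution (EM := EM) m :=
    generatorM_mem hincl hS (Submodule.projection_apply_mem (isCompl_gS hW hw (S.proj m)) η).1
  have hR : MDifferentiableAt 𝓘(ℝ, EM) 𝓘(ℝ, EG) (fun m' ↦ projW hW hw (S.proj m') ξ) m :=
    (((contMDiff_projW hW hw).comp (contMDiff_constraint_proj hincl)).clm_apply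
      contMDiff_const).mdifferentiableAt (by simp)
  -- The curvature at `m` sees only the value of the section there, so the section is replaced by
  -- the constant `ξ` and its field by a true infinitesimal generator.
  have h := extDerivOneForm_generator (mdifferentiableAt_connectionForm hincl hS hW hw m)
    (contMDiff_act hincl hS) (act_one hS)
    (v := X) (fun g ↦ by
      rw [connectionForm_eq_zero hincl hS hW hw hX,
        connectionForm_eq_zero hincl hS hW hw (mfderiv_act_mem hincl hS hX g)])
    (η := ξ) (h := fun m' ↦ projW hW hw (S.proj m') ξ) (fun m' ↦ by
      rw [← connectionForm_generatorM hincl hS hW hw]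
      exact oneForm_congr (connectionForm hS w) (act_one hS m').symm rfl) hR
    (u := generatorM hS m ξ) rfl
  rw [curvature, sectionFieldM, ← hξ, projC_eq_self hincl hS hW hw hX,
    projC_eq_self hincl hS hW hw hY]
  refine h.trans ?_
  obtain ⟨γ, hγ0, hγ, hγv⟩ := exists_curve m X
  subst hγ0
  have h1 := hasDerivAt_comp_curve hR hγ hγv
  have h2 := hasDerivAt_comp_curve
    ((contMDiff_pullbackProjGS hincl hW hw η).mdifferentiableAt (by simp)) hγ hγv
  let ξ' : EG := ξ
  -- Up to the constant `ξ'`, minus the contraction of `𝒜_𝓦` with the frozen generator is the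
  -- section itself.
  have h3 : ∀ t, ξ' - projW hW hw (S.proj (γ t)) ξ' = pullbackProjGS hW hw η (γ t) := fun t ↦
    (congrArg (ξ' - ·) (projW_projGS hW hw η (S.proj (γ 0)) (S.proj (γ t)))).trans
      (sub_sub_cancel ξ' _)
  have h4 := h1.const_sub ξ'
  exact (h4.congr_of_eventuallyEq (.of_forall fun t ↦ (h3 t).symm)).unique h2

end Connection

/-! ### Horizontal gauge momenta and the momentum equation. -/

section GaugeMomentum

variable {E : Type*} [NormedAddCommGroup E] [NormedSpace ℝ E]
  {Q : Type*} [TopologicalSpace Q] [ChartedSpace E Q] [IsManifold 𝓘(ℝ, E) ∞ Q]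
  {EG : Type*} [NormedAddCommGroup EG] [NormedSpace ℝ EG]
  {G : Type*} [TopologicalSpace G] [ChartedSpace EG G] [Group G] [LieGroup 𝓘(ℝ, EG) ∞ G]
  [MulAction G Q] [ContMDiffSMul 𝓘(ℝ, EG) 𝓘(ℝ, E) ∞ G Q]
  {S : System E Q}
  {EM : Type*} [NormedAddCommGroup EM] [NormedSpace ℝ EM] [ChartedSpace EM S.Constraint]
  {W : ∀ q : Q, Submodule ℝ (TangentSpace 𝓘(ℝ, E) q)}
  {w : Submodule ℝ (GroupLieAlgebra 𝓘(ℝ, EG) G)}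

theorem contMDiff_sum_smul {V ι : Type*} [NormedAddCommGroup V] [NormedSpace ℝ V] [Fintype ι]
    {f : ι → Q → ℝ} {g : ι → Q → V} (hf : ∀ i, ContMDiff 𝓘(ℝ, E) 𝓘(ℝ, ℝ) ∞ (f i))
    (hg : ∀ i, ContMDiff 𝓘(ℝ, E) 𝓘(ℝ, V) ∞ (g i)) :
    ContMDiff 𝓘(ℝ, E) 𝓘(ℝ, V) ∞ (fun q ↦ ∑ i, f i q • g i q) :=
  contMDiff_finsetSum fun i _ ↦ (hf i).smul (hg i)

/-- `Θ_𝓜` depends on a vector only through its projection to `Q`. The pairing is therefore pointwise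
in `χ`, and linear over functions on `Q`. -/
theorem nhMomentum_eq (hincl : IsSmoothEmbedding 𝓘(ℝ, EM) (cotangentModel E) ∞ S.incl)
    (hS : S.IsSymmetry G) (χ : Q → GroupLieAlgebra 𝓘(ℝ, EG) G) (m : S.Constraint) :
    nhMomentum EM hS χ m = momentumMap m (χ (S.proj m)) := by
  have hi : MDifferentiableAt 𝓘(ℝ, EM) (cotangentModel E) S.incl m :=
    hincl.contMDiff.mdifferentiableAt (by simp)
  have hp : MDifferentiableAt (cotangentModel E) 𝓘(ℝ, E) (fun α : Cotangent E Q ↦ α.proj)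
      (S.incl m) := contMDiff_cotangent_proj.mdifferentiableAt (by simp)
  have h1 := congrArg (fun B : EM →L[ℝ] E ↦ B (generatorM hS m (χ (S.proj m))))
    (mfderiv_comp m hp hi)
  have h2 := mfderiv_proj_generatorM hincl hS m (χ (S.proj m))
  exact congrArg (S.incl m).2 (h1.symm.trans h2)

theorem nhMomentum_sum (hincl : IsSmoothEmbedding 𝓘(ℝ, EM) (cotangentModel E) ∞ S.incl)
    (hS : S.IsSymmetry G) {ι : Type*} [Fintype ι] (f : ι → Q → ℝ)
    (ξ : ι → Q → GroupLieAlgebra 𝓘(ℝ, EG) G) (m : S.Constraint) :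
    nhMomentum EM hS (fun q ↦ ∑ i, f i q • ξ i q) m =
      ∑ i, f i (S.proj m) * nhMomentum EM hS (ξ i) m := by
  rw [nhMomentum_eq hincl, map_sum]
  refine Finset.sum_congr rfl fun i _ ↦ ?_
  rw [nhMomentum_eq hincl, map_smul, smul_eq_mul]

theorem contMDiff_nhMomentum (hincl : IsSmoothEmbedding 𝓘(ℝ, EM) (cotangentModel E) ∞ S.incl)
    (hS : S.IsSymmetry G) {χ : Q → GroupLieAlgebra 𝓘(ℝ, EG) G}
    (hχ : ContMDiff (M' := EG) 𝓘(ℝ, E) 𝓘(ℝ, EG) ∞ χ) :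
    ContMDiff 𝓘(ℝ, EM) 𝓘(ℝ, ℝ) ∞ (nhMomentum EM hS χ) := by
  have h : nhMomentum EM hS χ = fun m ↦ momentumMap m (χ (S.proj m)) :=
    funext (nhMomentum_eq hincl hS χ)
  rw [h]
  exact ((contMDiff_cotangentMomentum EG G).comp hincl.contMDiff).clm_apply
    (hχ.comp (contMDiff_constraint_proj hincl))

theorem projGS_mem (hW : S.IsVerticalComplement EG G W) (hw : VerticalSymmetry W w)
    (η : GroupLieAlgebra 𝓘(ℝ, EG) G) (q : Q) : projGS hW hw η q ∈ S.gS EG G q :=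
  Submodule.projection_apply_mem (isCompl_gS hW hw q) η

/-- The derivative of `⟨J^nh, P_{𝔤_S}(η)⟩` along the nonholonomic field is given by the
`𝓦`-curvature. -/
theorem deriv_nhMomentum_projGS [FiniteDimensional ℝ E] [FiniteDimensional ℝ EG]
    [IsManifold 𝓘(ℝ, EM) ∞ S.Constraint]
    (hincl : IsSmoothEmbedding 𝓘(ℝ, EM) (cotangentModel E) ∞ S.incl)
    (hS : S.IsSymmetry G) (hW : S.IsVerticalComplement EG G W) (hw : VerticalSymmetry W w)
    (η : GroupLieAlgebra 𝓘(ℝ, EG) G) (m : S.Constraint) :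
    S.deriv (nhMomentum EM hS (projGS hW hw η)) m (S.nonholonomicField (EM := EM) m) =
      formJK hS w m (sectionFieldM hS (projGS hW hw η) m)
        (S.nonholonomicField (EM := EM) m) := by
  have hX := nonholonomicField_mem (EM := EM) S m
  have hN := deriv_momentumMap_nonholonomicField hincl hS (projGS_mem hW hw η (S.proj m)).1
  have hμ : ContMDiff 𝓘(ℝ, EM) 𝓘(ℝ, EG →L[ℝ] ℝ) ∞
      (fun m : S.Constraint ↦ cotangentMomentum EG G (S.incl m)) :=
    (contMDiff_cotangentMomentum EG G).comp hincl.contMDiff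
  have hj := contMDiff_nhMomentum hincl hS (contMDiff_projGS hW hw η)
  rw [formJK, curvature_projGS hincl hS hW hw η m hX]
  obtain ⟨γ, hγ0, hγ, hγv⟩ := exists_curve m (S.nonholonomicField (EM := EM) m)
  subst hγ0
  let ξ' : EG := projGS hW hw η (S.proj (γ 0))
  have hσ := hasDerivAt_comp_curve
    ((contMDiff_pullbackProjGS hincl hW hw η).mdifferentiableAt (by simp)) hγ hγv
  have hμγ := hasDerivAt_comp_curve (hμ.mdifferentiableAt (by simp)) hγ hγv
  have h0 := hasDerivAt_comp_curve
    ((hμ.clm_apply (contMDiff_const (c := ξ'))).mdifferentiableAt (by simp)) hγ hγv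
  have h1 := hasDerivAt_comp_curve (hj.mdifferentiableAt (by simp)) hγ hγv
  -- The product-rule term in which only `𝒥` varies is the derivative of the momentum of the frozen
  -- `ξ'`, which the Noether identity makes zero.
  have h2 := (hμγ.clm_apply (hasDerivAt_const (0 : ℝ) ξ')).unique h0
  have h3 := (hμγ.clm_apply hσ).congr_of_eventuallyEq
    (.of_forall fun t ↦ nhMomentum_eq hincl hS (projGS hW hw η) (γ t))
  refine (h1.unique h3).trans ?_
  rw [map_zero, add_zero] at h2
  exact (congrArg (· + _) (h2.trans hN)).trans (zero_add _)

theorem hasDerivAt_sum_mul {ι : Type*} [Fintype ι] {a b : ι → ℝ → ℝ} {a' b' : ι → ℝ} {t : ℝ}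
    (ha : ∀ i, HasDerivAt (a i) (a' i) t) (hb : ∀ i, HasDerivAt (b i) (b' i) t) :
    HasDerivAt (fun s ↦ ∑ i, a i s * b i s) (∑ i, (b i t * a' i + a i t * b' i)) t := by
  refine (HasDerivAt.fun_sum fun i _ ↦ (ha i).mul (hb i)).congr_deriv ?_
  exact Finset.sum_congr rfl fun i _ ↦ by rw [mul_comm (a' i)]

/-- For a combination of the functions `⟨J^nh, P_{𝔤_S}(η_i)⟩`, the momentum equation expresses
conservation along the nonholonomic field. -/
theorem momentumEquation_iff [FiniteDimensional ℝ E] [FiniteDimensional ℝ EG]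
    [IsManifold 𝓘(ℝ, EM) ∞ S.Constraint]
    (hincl : IsSmoothEmbedding 𝓘(ℝ, EM) (cotangentModel E) ∞ S.incl)
    (hS : S.IsSymmetry G) (hW : S.IsVerticalComplement EG G W) (hw : VerticalSymmetry W w)
    {k : ℕ} (η : Fin k → GroupLieAlgebra 𝓘(ℝ, EG) G) {f : Fin k → Q → ℝ}
    (hf : ∀ i, ContMDiff 𝓘(ℝ, E) 𝓘(ℝ, ℝ) ∞ (f i)) {J : S.Constraint → ℝ}
    (hJ : ∀ m, J m = ∑ i, f i (S.proj m) * nhMomentum EM hS (projGS hW hw (η i)) m) :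
    MomentumEquation EM hS w (fun i ↦ projGS hW hw (η i)) f ↔
      ∀ m, S.deriv J m (S.nonholonomicField (EM := EM) m) = 0 := by
  refine forall_congr' fun m ↦ ?_
  have hfπ : ∀ i, ContMDiff 𝓘(ℝ, EM) 𝓘(ℝ, ℝ) ∞ (fun m' ↦ f i (S.proj m')) := fun i ↦
    (hf i).comp (contMDiff_constraint_proj hincl)
  have hj : ∀ i, ContMDiff 𝓘(ℝ, EM) 𝓘(ℝ, ℝ) ∞ (nhMomentum EM hS (projGS hW hw (η i))) :=
    fun i ↦ contMDiff_nhMomentum hincl hS (contMDiff_projGS hW hw (η i))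
  have hJs : ContMDiff 𝓘(ℝ, EM) 𝓘(ℝ, ℝ) ∞ J := by
    rw [funext hJ]
    exact ContMDiff.sum fun i _ ↦ (hfπ i).mul (hj i)
  -- The left side of the momentum equation is the Leibniz expansion of `X_nh(J)`, with `X_nh(j_i)`
  -- written through the curvature.
  suffices h : S.deriv J m (S.nonholonomicField (EM := EM) m) =
      ∑ i, (nhMomentum EM hS (projGS hW hw (η i)) m *
        S.deriv (fun m' ↦ f i (S.proj m')) m (S.nonholonomicField (EM := EM) m) +
      f i (S.proj m) * formJK hS w m (sectionFieldM hS (projGS hW hw (η i)) m)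
        (S.nonholonomicField (EM := EM) m)) by
    rw [h]
  simp_rw [← deriv_nhMomentum_projGS hincl hS hW hw]
  obtain ⟨γ, hγ0, hγ, hγv⟩ := exists_curve m (S.nonholonomicField (EM := EM) m)
  subst hγ0
  have h1 := hasDerivAt_comp_curve (hJs.mdifferentiableAt (by simp)) hγ hγv
  have h2 := hasDerivAt_sum_mul
    (fun i ↦ hasDerivAt_comp_curve ((hfπ i).mdifferentiableAt (by simp)) hγ hγv)
    (fun i ↦ hasDerivAt_comp_curve ((hj i).mdifferentiableAt (by simp)) hγ hγv)
  exact h1.unique (h2.congr_of_eventuallyEq (.of_forall fun t ↦ hJ (γ t)))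

/-! ### The `ξ_i` as a frame of `𝔤_S`. -/

section Basis

variable (hW : S.IsVerticalComplement EG G W) (hw : VerticalSymmetry W w) {k l : ℕ}
  (η : Module.Basis (Fin k ⊕ Fin l) ℝ (GroupLieAlgebra 𝓘(ℝ, EG) G))

/-- Apply the projection to the basis expansion of `ζ`: it fixes `ζ` and kills the vectors of `𝔴`.
The coefficients are linear functionals of `ζ` that do not depend on `q`. -/
theorem eq_sum_repr_projGS (hη : ∀ i, η (Sum.inr i) ∈ w) {q : Q}
    {ζ : GroupLieAlgebra 𝓘(ℝ, EG) G} (hζ : ζ ∈ S.gS EG G q) :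
    ζ = ∑ i, η.repr ζ (Sum.inl i) • projGS hW hw (η (Sum.inl i)) q := by
  have h1 : (S.gS EG G q).projection w (isCompl_gS hW hw q) ζ = ζ :=
    Submodule.projection_apply_of_mem_left _ hζ
  have h2 := congrArg ((S.gS EG G q).projection w (isCompl_gS hW hw q)) (η.sum_repr ζ)
  rw [h1, map_sum, Fintype.sum_sum_type] at h2
  simp only [map_smul] at h2
  have h3 : ∑ i, η.repr ζ (Sum.inr i) •
      (S.gS EG G q).projection w (isCompl_gS hW hw q) (η (Sum.inr i)) = 0 :=
    Finset.sum_eq_zero fun i _ ↦ by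
      rw [Submodule.projection_apply_of_mem_right _ (hη i), smul_zero]
  rw [h3, add_zero] at h2
  exact h2.symm

theorem repr_inl_eq_zero (hη : w ≤ Submodule.span ℝ (range fun i : Fin l ↦ η (Sum.inr i)))
    {ζ : GroupLieAlgebra 𝓘(ℝ, EG) G} (hζ : ζ ∈ w) (i : Fin k) : η.repr ζ (Sum.inl i) = 0 := by
  obtain ⟨c, rfl⟩ := (Submodule.mem_span_range_iff_exists_fun ℝ).1 (hη hζ)
  simp [map_sum]

/-- Projecting changes a basis vector by an element of `𝔴`, which has no coordinates in the first
block. -/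
theorem repr_projGS (hη : w ≤ Submodule.span ℝ (range fun i : Fin l ↦ η (Sum.inr i)))
    (i j : Fin k) (q : Q) : η.repr (projGS hW hw (η (Sum.inl j)) q) (Sum.inl i) =
      if j = i then 1 else 0 := by
  have h1 : η (Sum.inl j) - projGS hW hw (η (Sum.inl j)) q ∈ w := by
    obtain ⟨a, ha, b, hb, hab⟩ := Submodule.mem_sup.1
      ((isCompl_gS hW hw q).sup_eq_top ▸ Submodule.mem_top (x := η (Sum.inl j)))
    rw [← hab, projGS, map_add, Submodule.projection_apply_of_mem_left _ ha,
      Submodule.projection_apply_of_mem_right _ hb, add_zero, add_sub_cancel_left]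
    exact hb
  have h2 := repr_inl_eq_zero η hη h1 i
  rw [map_sub, Finsupp.sub_apply, sub_eq_zero] at h2
  rw [← h2, Module.Basis.repr_self, Finsupp.single_apply]
  simp

theorem repr_sum_projGS (hη : w ≤ Submodule.span ℝ (range fun i : Fin l ↦ η (Sum.inr i)))
    (c : Fin k → ℝ) (i : Fin k) (q : Q) :
    η.repr (∑ j, c j • projGS hW hw (η (Sum.inl j)) q) (Sum.inl i) = c i := by
  simp [map_sum, Finsupp.finsetSum_apply, repr_projGS hW hw η hη]

end Basis

end GaugeMomentum

end Nonholonomic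

end

theorem propositionP
    -- the configuration manifold `Q`
    {E : Type*} [NormedAddCommGroup E] [NormedSpace ℝ E] [FiniteDimensional ℝ E]
    {Q : Type*} [TopologicalSpace Q] [T2Space Q] [SecondCountableTopology Q]
    [ChartedSpace E Q] [IsManifold 𝓘(ℝ, E) ∞ Q]
    -- the Lie group `G`, acting smoothly and properly on `Q`
    {EG : Type*} [NormedAddCommGroup EG] [NormedSpace ℝ EG] [FiniteDimensional ℝ EG]
    {G : Type*} [TopologicalSpace G] [ChartedSpace EG G] [Group G] [LieGroup 𝓘(ℝ, EG) ∞ G]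
    [MulAction G Q] [ContMDiffSMul 𝓘(ℝ, EG) 𝓘(ℝ, E) ∞ G Q] [ProperSMul G Q]
    -- the nonholonomic system, and the structure of embedded submanifold of `T*Q` on `𝓜`
    (S : Nonholonomic.System E Q)
    {EM : Type*} [NormedAddCommGroup EM] [NormedSpace ℝ EM] [FiniteDimensional ℝ EM]
    [ChartedSpace EM S.Constraint] [IsManifold 𝓘(ℝ, EM) ∞ S.Constraint]
    (hincl : IsSmoothEmbedding 𝓘(ℝ, EM) (Nonholonomic.cotangentModel E) ∞ S.incl)
    -- the symmetry, and a vertical complement with the vertical-symmetry condition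
    (hS : S.IsSymmetry G)
    {W : ∀ q : Q, Submodule ℝ (TangentSpace 𝓘(ℝ, E) q)}
    (hW : S.IsVerticalComplement EG G W)
    {w : Submodule ℝ (GroupLieAlgebra 𝓘(ℝ, EG) G)}
    (hw : Nonholonomic.System.VerticalSymmetry W w)
    -- a basis of `𝔤` that extends a basis of `𝔴`, the sections `ξ_i` and the functions `j_i`
    {k l : ℕ} (η : Module.Basis (Fin k ⊕ Fin l) ℝ (GroupLieAlgebra 𝓘(ℝ, EG) G))
    (hη : Submodule.span ℝ (range fun i : Fin l ↦ η (Sum.inr i)) = w)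
    (ξ : Fin k → Q → GroupLieAlgebra 𝓘(ℝ, EG) G)
    (hξ : ∀ i, ξ i = Nonholonomic.System.projGS hW hw (η (Sum.inl i)))
    (j : Fin k → S.Constraint → ℝ)
    (hj : ∀ i, j i = Nonholonomic.System.nhMomentum EM hS (ξ i))
    (J : S.Constraint → ℝ) :
    -- the characterization of the horizontal gauge momenta
    (Nonholonomic.System.IsHorizontalGaugeMomentum EM EG hS J ↔
      ∃ f : Fin k → Q → ℝ, (∀ i, ContMDiff 𝓘(ℝ, E) 𝓘(ℝ, ℝ) ∞ (f i)) ∧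
        (∀ m, J m = ∑ i, f i (S.proj m) * j i m) ∧
        Nonholonomic.System.MomentumEquation EM hS w ξ f) ∧
    -- such functions `f_i` give the horizontal gauge symmetry `∑ f_i ξ_i` of `J`
    (∀ f : Fin k → Q → ℝ, (∀ i, ContMDiff 𝓘(ℝ, E) 𝓘(ℝ, ℝ) ∞ (f i)) →
      (∀ m, J m = ∑ i, f i (S.proj m) * j i m) →
      Nonholonomic.System.MomentumEquation EM hS w ξ f →
      Nonholonomic.System.IsHorizontalGaugeSymmetry EM hS (fun q ↦ ∑ i, f i q • ξ i q) J) ∧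
    -- and every horizontal gauge symmetry of `J` arises in this way
    (∀ χ : Q → GroupLieAlgebra 𝓘(ℝ, EG) G,
      Nonholonomic.System.IsHorizontalGaugeSymmetry EM hS χ J →
      ∃! f : Fin k → Q → ℝ, (∀ i, ContMDiff 𝓘(ℝ, E) 𝓘(ℝ, ℝ) ∞ (f i)) ∧
        (∀ q, χ q = ∑ i, f i q • ξ i q) ∧
        (∀ m, J m = ∑ i, f i (S.proj m) * j i m) ∧
        Nonholonomic.System.MomentumEquation EM hS w ξ f) := by
  obtain rfl : ξ = fun i ↦ Nonholonomic.System.projGS hW hw (η (Sum.inl i)) := funext hξ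
  obtain rfl : j = fun i ↦ Nonholonomic.System.nhMomentum EM hS
    (Nonholonomic.System.projGS hW hw (η (Sum.inl i))) := funext hj
  have hηw : ∀ i, η (Sum.inr i) ∈ w := fun i ↦ hη ▸ Submodule.subset_span ⟨i, rfl⟩
  have hsymm : ∀ f : Fin k → Q → ℝ, (∀ i, ContMDiff 𝓘(ℝ, E) 𝓘(ℝ, ℝ) ∞ (f i)) →
      (∀ m, J m = ∑ i, f i (S.proj m) * Nonholonomic.System.nhMomentum EM hS
        (Nonholonomic.System.projGS hW hw (η (Sum.inl i))) m) →
      Nonholonomic.System.MomentumEquation EM hS w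
        (fun i ↦ Nonholonomic.System.projGS hW hw (η (Sum.inl i))) f →
      Nonholonomic.System.IsHorizontalGaugeSymmetry EM hS
        (fun q ↦ ∑ i, f i q • Nonholonomic.System.projGS hW hw (η (Sum.inl i)) q) J := by
    intro f hf hJ heq
    have hs : ContMDiff (M' := EG) 𝓘(ℝ, E) 𝓘(ℝ, EG) ∞
        (fun q ↦ ∑ i, f i q • Nonholonomic.System.projGS hW hw (η (Sum.inl i)) q) :=
      Nonholonomic.contMDiff_sum_smul (V := EG) hf fun i ↦
        Nonholonomic.contMDiff_projGS hW hw (η (Sum.inl i))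
    have hJ' : ∀ m, J m = Nonholonomic.System.nhMomentum EM hS
        (fun q ↦ ∑ i, f i q • Nonholonomic.System.projGS hW hw (η (Sum.inl i)) q) m := fun m ↦
      (hJ m).trans (Nonholonomic.nhMomentum_sum hincl hS f _ m).symm
    exact
      { contMDiff_section := hs
        mem_gS := fun q ↦ Submodule.sum_mem _ fun i _ ↦
          Submodule.smul_mem _ _ (Nonholonomic.projGS_mem hW hw _ q)
        contMDiff_momentum := funext hJ' ▸ Nonholonomic.contMDiff_nhMomentum hincl hS hs
        eq_nhMomentum := hJ'
        conserved := (Nonholonomic.momentumEquation_iff hincl hS hW hw _ hf hJ).1 heq }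
  have huniq : ∀ χ : Q → GroupLieAlgebra 𝓘(ℝ, EG) G,
      Nonholonomic.System.IsHorizontalGaugeSymmetry EM hS χ J →
      ∃! f : Fin k → Q → ℝ, (∀ i, ContMDiff 𝓘(ℝ, E) 𝓘(ℝ, ℝ) ∞ (f i)) ∧
        (∀ q, χ q = ∑ i, f i q • Nonholonomic.System.projGS hW hw (η (Sum.inl i)) q) ∧
        (∀ m, J m = ∑ i, f i (S.proj m) * Nonholonomic.System.nhMomentum EM hS
          (Nonholonomic.System.projGS hW hw (η (Sum.inl i))) m) ∧
        Nonholonomic.System.MomentumEquation EM hS w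
          (fun i ↦ Nonholonomic.System.projGS hW hw (η (Sum.inl i))) f := by
    intro χ hχ
    -- The coefficient functions are fixed linear functionals applied to the smooth map `χ`.
    have hf : ∀ i, ContMDiff 𝓘(ℝ, E) 𝓘(ℝ, ℝ) ∞ (fun q ↦ η.repr (χ q) (Sum.inl i)) := fun i ↦
      (LinearMap.toContinuousLinearMap (𝕜 := ℝ) (E := EG) (F' := ℝ)
        (η.coord (Sum.inl i))).contMDiff.comp hχ.contMDiff_section
    have hsum : ∀ q, χ q = ∑ i, η.repr (χ q) (Sum.inl i) •
        Nonholonomic.System.projGS hW hw (η (Sum.inl i)) q := fun q ↦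
      Nonholonomic.eq_sum_repr_projGS hW hw η hηw (hχ.mem_gS q)
    have hJ : ∀ m, J m = ∑ i, η.repr (χ (S.proj m)) (Sum.inl i) *
        Nonholonomic.System.nhMomentum EM hS
          (Nonholonomic.System.projGS hW hw (η (Sum.inl i))) m := fun m ↦ by
      rw [hχ.eq_nhMomentum, funext hsum]
      refine (Nonholonomic.nhMomentum_sum hincl hS (fun i q ↦ η.repr (χ q)
          (Sum.inl i)) _ m).trans ?_
      rw [← funext hsum]
    refine ⟨fun i q ↦ η.repr (χ q) (Sum.inl i), ⟨hf, hsum, hJ,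
      (Nonholonomic.momentumEquation_iff hincl hS hW hw _ hf hJ).2 hχ.conserved⟩, ?_⟩
    -- Uniqueness uses only the expansion of `χ`: the coordinate functionals recover each `f i` from
    -- it.
    rintro f ⟨-, hfχ, -, -⟩
    funext i q
    rw [hfχ q, Nonholonomic.repr_sum_projGS hW hw η hη.ge]
  refine ⟨⟨fun ⟨χ, hχ⟩ ↦ ?_, fun ⟨f, hf, hJ, heq⟩ ↦ ⟨_, hsymm f hf hJ heq⟩⟩, hsymm, huniq⟩
  obtain ⟨f, ⟨hf, -, hJ, heq⟩, -⟩ := huniq χ hχ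
  exact ⟨f, hf, hJ, heq⟩
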